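/- Let $G$ be a finite connected graph (loops and multiple edges allowed) with nonempty edge set $E$. Every edge has two half-edges, each attached to an endpoint (for a loop both to the same vertex), and every edge carries two opposite arcs. An *orientation* is a set of arcs containing exactly one arc of each edge. A *directed cycle* is the set of arcs of a simple closed directed walk (loops included); a *cocycle* is an inclusion-minimal nonempty edge cut, and a *directed cocycle* is a cocycle with all its edges directed from one side of the cut to the other. Reversing a directed cycle (resp. a directed cycle or directed cocycle, resp. a directed cocycle) contained in an orientation generates an equivalence relation on orientations, whose classes are the *cycle* (resp. *cycle–cocycle*, resp. *cocycle*) *reversal classes*; $[\overrightarrow{O}]$ denotes the cycle–cocycle reversal class of $\overrightarrow{O}$. Spanning trees and subgraphs are identified with their edge sets. Let $G$ carry a ribbon structure (a cyclic order of the half-edges around each vertex), and fix a starting half-edge $h_0$ (an edge $e_0$ with a chosen end), attached to the vertex $q$. For a spanning tree $B$, the *Bernardi tour* starts at $h_0$; at a half-edge $h$ whose edge is not in $B$ it cuts that edge and moves on to the half-edge following $h$ around its vertex; at a half-edge whose edge is in $B$ it walks along the edge to the opposite half-edge $h'$ and moves on to the half-edge following $h'$ around its vertex. Define the following sets of arcs,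 which contain both arcs of some edges. * $\mathcal{A}_{\mathrm{B}}(B)$ contains both arcs of each edge of $B$ and, for each edge not in $B$, only the arc directed towards the end at which the tour first cuts the edge. * $\mathcal{A}_q^*(B)$ contains both arcs of each edge not in $B$ and, for each edge of $B$, only the arc directed away from $q$ in $B$. * A *cocycle signature* $\sigma^*$ is a choice of one of the two directions of each cocycle. $\mathcal{A}^*_{\sigma^*}(B)$ contains both arcs of each edge not in $B$ and, for each edge $e$ of $B$, only the arc of $e$ that lies in the member of $\sigma^*$ supported on the fundamental cocycle of $e$ (the unique cocycle contained in $(E\setminus B)\cup\{e\}$). The signature $\sigma^*$ is *triangulating* if, for every spanning tree $B$, every directed cocycle contained in $\mathcal{A}^*_{\sigma^*}(B)$ belongs to $\sigma^*$. Let $\mathcal{A}^*$ be $\mathcal{A}_q^*$ or $\mathcal{A}^*_{\sigma^*}$ for any triangulating cocycle signature $\sigma^*$. Then $f(B)=\mathcal{A}_{\mathrm{B}}(B)\cap\mathcal{A}^*(B)$ is an orientation for every spanning tree $B$ (for $\mathcal{A}^*=\mathcal{A}^*_q$ this $f$ is the Bernardi map), and the following hold. 1. The map $B\mapsto[f(B)]$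 is a bijection from the spanning trees of $G$ to the cycle–cocycle reversal classes of $G$. 2. For each orientation $\overrightarrow{O}$ there is a spanning tree $B$ (the unique one with $f(B)\in[\overrightarrow{O}]$) such that $\overrightarrow{O}$ is obtained from $f(B)$ by reversing pairwise disjoint directed cycles $\overrightarrow{C_i}$ $(i\in I)$ and directed cocycles $\overrightarrow{C_j^*}$ $(j\in J)$ contained in $f(B)$. The set $$\varphi(\overrightarrow{O})=\Bigl(B\cup\bigcup_{i\in I}C_i\Bigr)\setminus\bigcup_{j\in J}C_j^*$$ (where $C_i$, $C_j^*$ are the underlying edge sets) does not depend on the choice of these cycles and cocycles, and $\varphi$ is a bijection from the orientations of $G$ to the subsets of $E$ with $\varphi(f(B))=B$ for every spanning tree $B$. Moreover, the orientations $\overrightarrow{O}$ for which $\varphi(\overrightarrow{O})$ is a forest (contains no cycle) form a set of representatives of the cycle reversal classes, and those for which $\varphi(\overrightarrow{O})$ is the edge set of a connected spanning subgraph form a set of representatives of the cocycle reversal classes. -/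

import Mathlib

/-- A half-edge of a graph with edge type `E`; the two half-edges of `e` are `(e, true)` and
`(e, false)`, also when `e` is a loop. The same pairs encode the arcs (directed edges): the arc `a`
leaves its edge's half-edge `a` (its tail end) and enters along the opposite half-edge `a.rev`
(its head end). -/
abbrev HalfEdge (E : Type*) := E × Bool

/-- The opposite half-edge of the same edge; as an operation on arcs, reversal. -/
def HalfEdge.rev {E : Type*} (a : HalfEdge E) : HalfEdge E := (a.1, !a.2)

/-- The set of edges underlying a set of arcs. -/
def arcEdges {E : Type*} (C : Set (HalfEdge E)) : Set E := Prod.fst '' C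

/-- Reversal of a set of arcs, `C ↦ -C`. -/
def revArcs {E : Type*} (C : Set (HalfEdge E)) : Set (HalfEdge E) := {a | a.rev ∈ C}

/-- An orientation picks exactly one of the two arcs of every edge. -/
abbrev EdgeOrientation (E : Type*) := E → Bool

/-- The set of arcs of an orientation. -/
def EdgeOrientation.arcs {E : Type*} (O : EdgeOrientation E) : Set (HalfEdge E) :=
  {a | O a.1 = a.2}

/-- `O'` is obtained from `O` by reversing the arcs of `O` that lie in `C`. -/
def IsReversalOf {E : Type*} (O O' : EdgeOrientation E) (C : Set (HalfEdge E)) : Prop :=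
  C ⊆ O.arcs ∧ O'.arcs = (O.arcs \ C) ∪ revArcs C

/-- A graph with vertex type `V` and edge type `E`, loops and multiple edges allowed: each
half-edge is attached to a vertex. -/
structure Multigraph (V E : Type*) where
  /-- The vertex to which a half-edge is attached. -/
  vert : HalfEdge E → V

namespace Multigraph

variable {V E : Type*} (G : Multigraph V E)

/-- The tail of an arc. -/
def tail (a : HalfEdge E) : V := G.vert a

/-- The head of an arc. -/
def head (a : HalfEdge E) : V := G.vert a.rev

/-- `v` can be reached from `u` along edges in `T` (in any direction). -/
def Reach (T : Set E) : V → V → Prop :=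
  Relation.ReflTransGen fun u v => ∃ a : HalfEdge E, a.1 ∈ T ∧ G.tail a = u ∧ G.head a = v

/-- The spanning subgraph with edge set `T` is connected. -/
def IsConnectedSpanning (T : Set E) : Prop := ∀ u v : V, G.Reach T u v

/-- A connected graph (nonempty, and any two vertices are joined by a path). -/
def Connected : Prop := Nonempty V ∧ G.IsConnectedSpanning Set.univ

/-- `C` is the set of arcs of a directed cycle: a closed directed walk of positive length that
repeats neither a vertex nor an edge. Indices are taken cyclically, addition in `Fin (n + 1)`
being modulo `n + 1`; loops are cycles of length one. -/
def IsDirectedCycle (C : Set (HalfEdge E)) : Prop :=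
  ∃ (n : ℕ) (c : Fin (n + 1) → HalfEdge E),
    (∀ i, G.head (c i) = G.tail (c (i + 1))) ∧
    Function.Injective (fun i => G.tail (c i)) ∧
    Function.Injective (fun i => (c i).1) ∧
    C = Set.range c

/-- The arcs that leave the vertex set `S`. -/
def outCut (S : Set V) : Set (HalfEdge E) := {a | G.tail a ∈ S ∧ G.head a ∉ S}

/-- `C` is a directed cocycle (directed bond): the set of arcs leaving some vertex set, where the
underlying set of edges is minimal among nonempty edge cuts. -/
def IsDirectedCocycle (C : Set (HalfEdge E)) : Prop :=
  C.Nonempty ∧ ∃ S : Set V, C = G.outCut S ∧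
    ∀ S' : Set V, (G.outCut S').Nonempty → arcEdges (G.outCut S') ⊆ arcEdges C →
      arcEdges (G.outCut S') = arcEdges C

/-- The edge set `T` contains no cycle. -/
def IsForest (T : Set E) : Prop := ∀ C, G.IsDirectedCycle C → ¬ arcEdges C ⊆ T

/-- The edge set `T` is the edge set of a spanning tree. -/
def IsSpanningTree (T : Set E) : Prop := G.IsForest T ∧ G.IsConnectedSpanning T

/-- The type of spanning trees, given by their edge sets. -/
abbrev SpanningTree := {T : Set E // G.IsSpanningTree T}

/-- A single cycle reversal. -/
def CycleReversal (O O' : EdgeOrientation E) : Prop :=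
  ∃ C, G.IsDirectedCycle C ∧ IsReversalOf O O' C

/-- A single cocycle reversal. -/
def CocycleReversal (O O' : EdgeOrientation E) : Prop :=
  ∃ C, G.IsDirectedCocycle C ∧ IsReversalOf O O' C

/-- The equivalence relation whose classes are the cycle reversal classes. -/
def cycleSetoid : Setoid (EdgeOrientation E) :=
  Relation.EqvGen.setoid G.CycleReversal

/-- The equivalence relation whose classes are the cocycle reversal classes. -/
def cocycleSetoid : Setoid (EdgeOrientation E) :=
  Relation.EqvGen.setoid G.CocycleReversal

/-- The equivalence relation whose classes are the cycle-cocycle reversal classes. -/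
def cycleCocycleSetoid : Setoid (EdgeOrientation E) :=
  Relation.EqvGen.setoid fun O O' => G.CycleReversal O O' ∨ G.CocycleReversal O O'

/-- A ribbon structure: a cyclic order of the half-edges around each vertex. It is encoded by the
permutation sending each half-edge to the next one around its vertex, so that the cycles of this
permutation are exactly the sets of half-edges at a common vertex. -/
structure RibbonStructure where
  /-- The next half-edge around the same vertex. -/
  next : Equiv.Perm (HalfEdge E)
  sameCycle_iff : ∀ h k : HalfEdge E, next.SameCycle h k ↔ G.vert h = G.vert k

variable {G}

open Classical in
/-- One step of the Bernardi tour around `T`. If the edge of the current half-edge `h` is not in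
`T`, the tour cuts it and goes on to the next half-edge around the same vertex; if it is in `T`, the
tour walks along it to the opposite half-edge and goes on to the half-edge after that one. -/
noncomputable def RibbonStructure.tourStep (R : G.RibbonStructure) (T : Set E)
    (h : HalfEdge E) : HalfEdge E :=
  if h.1 ∈ T then R.next h.rev else R.next h

/-- The Bernardi tour around `T` that starts with the half-edge `h₀` reaches the half-edge `h`,
and does so before it reaches the opposite half-edge `h.rev`. -/
def RibbonStructure.ReachesFirst (R : G.RibbonStructure) (h₀ : HalfEdge E) (T : Set E)
    (h : HalfEdge E) : Prop :=
  ∃ n : ℕ, (R.tourStep T)^[n] h₀ = h ∧ ∀ m < n, (R.tourStep T)^[m] h₀ ≠ h.rev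

/-- The Bernardi external atlas: edges of `T` are bioriented, and an edge outside `T` is oriented
towards the end at which the tour cuts it first. -/
def RibbonStructure.bernardiAtlas (R : G.RibbonStructure) (h₀ : HalfEdge E) (T : Set E) :
    Set (HalfEdge E) :=
  {a | a.1 ∈ T ∨ R.ReachesFirst h₀ T a.rev}

variable (G)

/-- The internal atlas of a root `q`: edges outside `T` are bioriented, and an edge `e` of `T` is
oriented away from `q`, that is, its tail is joined to `q` in `T \ {e}`. -/
def rootAtlas (q : V) (T : Set E) : Set (HalfEdge E) :=
  {a | a.1 ∉ T ∨ G.Reach (T \ {a.1}) q (G.tail a)}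

/-- A cocycle signature, given as the set of the chosen directed cocycles: for each cocycle exactly
one of its two directions is chosen. -/
def IsCocycleSignature (σ : Set (Set (HalfEdge E))) : Prop :=
  (∀ C ∈ σ, G.IsDirectedCocycle C) ∧
    ∀ C, G.IsDirectedCocycle C → Xor (C ∈ σ) (revArcs C ∈ σ)

/-- The internal atlas of a cocycle signature `σ`: edges outside `T` are bioriented, and an edge `e`
of `T` is oriented as in the member of `σ` on the fundamental cocycle of `e`, the cocycle contained
in `Tᶜ ∪ {e}`. -/
def signatureAtlas (σ : Set (Set (HalfEdge E))) (T : Set E) : Set (HalfEdge E) :=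
  {a | a.1 ∉ T ∨ ∃ C ∈ σ, arcEdges C ⊆ Tᶜ ∪ {a.1} ∧ a ∈ C}

/-- A cocycle signature `σ` is triangulating if every directed cocycle contained in a member of its
internal atlas belongs to `σ`. -/
def IsTriangulating (σ : Set (Set (HalfEdge E))) : Prop :=
  ∀ T, G.IsSpanningTree T → ∀ C, G.IsDirectedCocycle C → C ⊆ signatureAtlas σ T → C ∈ σ

/-- `f` is the map `T ↦ A T ∩ A' T` from spanning trees to orientations induced by the external
atlas `A` and the internal atlas `A'`. -/
def IsInducedMap (A A' : Set E → Set (HalfEdge E)) (f : G.SpanningTree → EdgeOrientation E) :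
    Prop :=
  ∀ T, (f T).arcs = A T ∩ A' T

/-- The orientations `O` and `O'` differ by the disjoint directed cycles in `𝒞` and directed
cocycles in `𝒟`: reversing them all in `O` gives `O'`. -/
structure DifferBy (O O' : EdgeOrientation E) (𝒞 𝒟 : Set (Set (HalfEdge E))) : Prop where
  cycles : ∀ C ∈ 𝒞, G.IsDirectedCycle C
  cocycles : ∀ D ∈ 𝒟, G.IsDirectedCocycle D
  disjoint_cycles : 𝒞.PairwiseDisjoint id
  disjoint_cocycles : 𝒟.PairwiseDisjoint id
  disjoint : ∀ C ∈ 𝒞, ∀ D ∈ 𝒟, Disjoint C D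
  reversal : IsReversalOf O O' (⋃₀ 𝒞 ∪ ⋃₀ 𝒟)

/-- `φ` is the map from orientations to subgraphs that extends the inverse of the map `f` from
spanning trees to orientations, and it has the properties of a subgraph-orientation bijection. -/
structure IsSubgraphOrientationBijection (f : G.SpanningTree → EdgeOrientation E)
    (φ : EdgeOrientation E → Set E) : Prop where
  /-- Each orientation differs from some `f T` by disjoint directed cycles and cocycles. -/
  exists_differBy : ∀ O, ∃ T 𝒞 𝒟, G.DifferBy (f T) O 𝒞 𝒟
  /-- For every choice of them, this is the value of `φ`. -/
  map_eq : ∀ O T 𝒞 𝒟, G.DifferBy (f T) O 𝒞 𝒟 →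
    φ O = (T.1 ∪ arcEdges (⋃₀ 𝒞)) \ arcEdges (⋃₀ 𝒟)
  extends_inverse : ∀ T, φ (f T) = T
  bijective : Function.Bijective φ
  /-- The orientations that correspond to forests represent the cycle reversal classes. -/
  forests : Function.Bijective fun O : {O // G.IsForest (φ O)} => Quotient.mk G.cycleSetoid O.1
  /-- The orientations that correspond to connected spanning subgraphs represent the cocycle
  reversal classes. -/
  connected : Function.Bijective
    fun O : {O // G.IsConnectedSpanning (φ O)} => Quotient.mk G.cocycleSetoid O.1

end Multigraph

/-! The proof is linear algebra over the integers. The difference of the indicator functions of two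
orientations is an antisymmetric chain with values in {-1, 0, 1}. Cycle reversals change it by flows
and cocycle reversals by tensions (coboundaries), and these two lattices are orthogonal. If a flow
plus a tension has values in {-1, 0, 1}, their pointwise product is nowhere positive; since it sums
to zero, it vanishes, so the supports are disjoint (`disjoint_supports`). Both chains then have
values in {-1, 0, 1} and split into disjoint directed cycles and cocycles. Hence equivalent
orientations differ by reversing a directed flow `X` and a disjoint directed tension `Y`
(`cycleCocycleSetoid_iff`), and the pair is unique because a chain that is both a flow and a tension
is orthogonal to itself.

Two properties of the atlases drive the injectivity. The Bernardi atlas is dissecting: for two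
distinct trees, a vertex set `W` built from the first disagreement of the tours is entered by no arc
that lies in the first external atlas and whose reverse lies in the second (`exists_cut_of_ne`). The
internal atlas is triangulating: the arcs on which the tension may not be positive strongly connect
the graph (`dreach_of_isTriangulating`). So the tension vanishes, the flow vanishes on the cut of
`W`, and comparing the two orientations edge by edge shows that none of those strongly connecting
arcs enters `W`, which is absurd (`false_of_flow_of_tension`). The rooted atlas is the special case
of the signature directing all cocycles away from `q`.

Surjectivity onto the classes comes from counting. Indegrees away from `q`, modulo the reduced
Laplacian lattice, separate the classes, and the index of this lattice is at most the number of
spanning trees by the Cauchy–Binet argument (`card_classes_le`). Similarly, since orientations and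
edge sets are equinumerous, `φ` only has to be injective. Equal subgraphs come from equal trees by
`false_of_flow_of_tension`, applied to the differences of the two flows and of the two tensions. For
a fixed tree, the subgraph determines the flow off the tree and the tension on it, hence both.
Finally, `φ O` is a forest iff `X` is empty and connected iff `Y` is empty, so the representatives
arise by reversing only one of the two parts. -/

namespace HalfEdge

variable {E : Type*}

@[simp] theorem rev_rev (a : HalfEdge E) : a.rev.rev = a := by simp [rev]

@[simp] theorem rev_fst (a : HalfEdge E) : a.rev.1 = a.1 := rfl

theorem rev_ne (a : HalfEdge E) : a.rev ≠ a := by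
  intro h
  have := congrArg Prod.snd h
  simp [rev] at this

theorem rev_injective : Function.Injective (rev : HalfEdge E → HalfEdge E) :=
  Function.LeftInverse.injective rev_rev

theorem eq_or_eq_rev {a b : HalfEdge E} (h : a.1 = b.1) : a = b ∨ a = b.rev := by
  rcases a with ⟨e, s⟩
  rcases b with ⟨e', s'⟩
  obtain rfl : e = e' := h
  cases s <;> cases s' <;> simp [rev]

/-- Reversal as a permutation of the arcs. -/
def revEquiv : Equiv.Perm (HalfEdge E) := ⟨rev, rev, rev_rev, rev_rev⟩

end HalfEdge

open HalfEdge

/-! ### Arc sets, orientations and their reversals. -/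

section Arcs

variable {E : Type*}

@[simp] theorem mem_revArcs {C : Set (HalfEdge E)} {a : HalfEdge E} :
    a ∈ revArcs C ↔ a.rev ∈ C := Iff.rfl

@[simp] theorem revArcs_revArcs (C : Set (HalfEdge E)) : revArcs (revArcs C) = C := by
  ext a; simp

theorem mem_arcEdges {C : Set (HalfEdge E)} {a : HalfEdge E} :
    a.1 ∈ arcEdges C ↔ a ∈ C ∨ a.rev ∈ C := by
  constructor
  · rintro ⟨b, hb, h⟩
    rcases eq_or_eq_rev h with rfl | rfl
    · exact Or.inl hb
    · exact Or.inr hb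
  · rintro (h | h)
    · exact ⟨a, h, rfl⟩
    · exact ⟨a.rev, h, rfl⟩

theorem arcEdges_mono {C D : Set (HalfEdge E)} (h : C ⊆ D) : arcEdges C ⊆ arcEdges D :=
  Set.image_mono h

theorem arcEdges_subset_iff {C : Set (HalfEdge E)} {T : Set E} :
    arcEdges C ⊆ T ↔ ∀ a ∈ C, a.1 ∈ T := by
  exact Set.image_subset_iff

@[simp] theorem arcEdges_revArcs (C : Set (HalfEdge E)) : arcEdges (revArcs C) = arcEdges C := by
  ext e
  rw [show e = ((e, true) : HalfEdge E).1 from rfl, mem_arcEdges, mem_arcEdges]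
  simp [or_comm]

namespace EdgeOrientation

theorem rev_mem_arcs (O : EdgeOrientation E) (a : HalfEdge E) : a.rev ∈ O.arcs ↔ a ∉ O.arcs := by
  rcases a with ⟨e, s⟩
  cases s <;> simp [arcs, rev]

theorem ext_arcs {O O' : EdgeOrientation E} (h : O.arcs = O'.arcs) : O = O' := by
  funext e
  have h1 : ((e, O e) : HalfEdge E) ∈ O.arcs := rfl
  rw [h] at h1
  exact Eq.symm h1

/-- A set with exactly one arc of every edge is the set of arcs of an orientation. -/
theorem exists_arcs_eq {X : Set (HalfEdge E)} (h : ∀ a : HalfEdge E, a.rev ∈ X ↔ a ∉ X) :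
    ∃ O : EdgeOrientation E, O.arcs = X := by
  classical
  refine ⟨fun e => decide ((e, true) ∈ X), ?_⟩
  ext ⟨e, s⟩
  have h1 : ((e, false) : HalfEdge E) ∈ X ↔ (e, true) ∉ X := h (e, true)
  cases s
  · simp only [arcs, Set.mem_ofPred_eq, decide_eq_false_iff_not, h1]
  · simp only [arcs, Set.mem_ofPred_eq, decide_eq_true_eq]

theorem rev_not_mem_of_subset {O : EdgeOrientation E} {X : Set (HalfEdge E)} (h : X ⊆ O.arcs)
    {a : HalfEdge E} (ha : a ∈ X) : a.rev ∉ X :=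
  fun h' => (O.rev_mem_arcs a).1 (h h') (h ha)

end EdgeOrientation

theorem IsReversalOf.diff_eq {O O' : EdgeOrientation E} {C : Set (HalfEdge E)}
    (h : IsReversalOf O O' C) : C = O.arcs \ O'.arcs := by
  ext a
  have hC : a ∈ C → a ∈ O.arcs := fun h' => h.1 h'
  have hC' : a.rev ∈ C → a.rev ∈ O.arcs := fun h' => h.1 h'
  rw [O.rev_mem_arcs] at hC'
  rw [h.2]
  simp only [Set.mem_sdiff, Set.mem_union, mem_revArcs]
  tauto

theorem isReversalOf_diff (O O' : EdgeOrientation E) : IsReversalOf O O' (O.arcs \ O'.arcs) := by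
  refine ⟨Set.sdiff_subset, ?_⟩
  ext a
  simp only [Set.mem_sdiff, Set.mem_union, mem_revArcs, O.rev_mem_arcs, O'.rev_mem_arcs]
  tauto

theorem exists_isReversalOf {O : EdgeOrientation E} {C : Set (HalfEdge E)} (h : C ⊆ O.arcs) :
    ∃ O', IsReversalOf O O' C := by
  obtain ⟨O', hO'⟩ := EdgeOrientation.exists_arcs_eq (X := (O.arcs \ C) ∪ revArcs C) (by
    intro a
    have hC : a ∈ C → a ∈ O.arcs := fun h' => h h'
    have hC' : a.rev ∈ C → a.rev ∈ O.arcs := fun h' => h h'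
    rw [O.rev_mem_arcs] at hC'
    simp only [Set.mem_sdiff, Set.mem_union, mem_revArcs, O.rev_mem_arcs, rev_rev]
    tauto)
  exact ⟨O', h, hO'⟩

end Arcs

/-! ### Directed and undirected reachability. -/

namespace Multigraph

variable {V E : Type*} {G : Multigraph V E}

@[simp] theorem tail_rev (a : HalfEdge E) : G.tail a.rev = G.head a := rfl

@[simp] theorem head_rev (a : HalfEdge E) : G.head a.rev = G.tail a := by
  simp [head, tail]

/-- `v` can be reached from `u` along arcs in `X`. -/
def DReach (G : Multigraph V E) (X : Set (HalfEdge E)) : V → V → Prop :=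
  Relation.ReflTransGen fun u v => ∃ a ∈ X, G.tail a = u ∧ G.head a = v

theorem reach_iff_dreach {T : Set E} {u v : V} :
    G.Reach T u v ↔ G.DReach {a | a.1 ∈ T} u v := Iff.rfl

theorem DReach.exists_exit {X : Set (HalfEdge E)} {u v : V} (huv : G.DReach X u v) {S : Set V}
    (hu : u ∈ S) (hv : v ∉ S) : ∃ a ∈ X, G.tail a ∈ S ∧ G.head a ∉ S := by
  induction huv with
  | refl => exact absurd hu hv
  | @tail b c _ hbc ih =>
    obtain ⟨a, ha, rfl, rfl⟩ := hbc
    by_cases hb : G.tail a ∈ S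
    · exact ⟨a, ha, hb, hv⟩
    · exact ih hb

theorem DReach.tail_step {X : Set (HalfEdge E)} {u : V} {a : HalfEdge E}
    (h : G.DReach X u (G.tail a)) (ha : a ∈ X) : G.DReach X u (G.head a) :=
  Relation.ReflTransGen.tail h ⟨a, ha, rfl, rfl⟩

theorem Reach.mono {T T' : Set E} (h : T ⊆ T') {u v : V} (huv : G.Reach T u v) :
    G.Reach T' u v :=
  Relation.ReflTransGen.mono (fun _ _ ⟨a, ha, h'⟩ => ⟨a, h ha, h'⟩) _ _ huv

theorem Reach.tail_step {T : Set E} {u : V} {a : HalfEdge E}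
    (h : G.Reach T u (G.tail a)) (ha : a.1 ∈ T) : G.Reach T u (G.head a) :=
  Relation.ReflTransGen.tail h ⟨a, ha, rfl, rfl⟩

theorem Reach.symm {T : Set E} {u v : V} (h : G.Reach T u v) : G.Reach T v u := by
  induction h with
  | refl => exact Relation.ReflTransGen.refl
  | tail _ hbc ih =>
    obtain ⟨a, ha, rfl, rfl⟩ := hbc
    exact Relation.ReflTransGen.head ⟨a.rev, ha, by simp, by simp⟩ ih

theorem Reach.trans {T : Set E} {u v w : V} (h : G.Reach T u v) (h' : G.Reach T v w) :
    G.Reach T u w := Relation.ReflTransGen.trans h h'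

theorem Reach.exists_exit {T : Set E} {u v : V} (huv : G.Reach T u v) {S : Set V}
    (hu : u ∈ S) (hv : v ∉ S) : ∃ a : HalfEdge E, a.1 ∈ T ∧ G.tail a ∈ S ∧ G.head a ∉ S :=
  DReach.exists_exit (reach_iff_dreach.1 huv) hu hv

/-! ### Directed cycles from shortest walks. -/

section CycleExtraction

variable (G)

/-- `t` is reached from `v` by a walk of length `n` in `X`. -/
def StepsTo (X : Set (HalfEdge E)) (t : V) : ℕ → V → Prop
  | 0, v => v = t
  | n + 1, v => ∃ a ∈ X, G.tail a = v ∧ StepsTo X t n (G.head a)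

variable {G}

theorem DReach.exists_stepsTo {X : Set (HalfEdge E)} {t v : V} (h : G.DReach X v t) :
    ∃ n, G.StepsTo X t n v := by
  induction h using Relation.ReflTransGen.head_induction_on with
  | refl => exact ⟨0, rfl⟩
  | head hab _ ih =>
    obtain ⟨a, ha, rfl, rfl⟩ := hab
    obtain ⟨n, hn⟩ := ih
    exact ⟨n + 1, a, ha, rfl, hn⟩

/-- The `i`-th vertex of a shortest walk is at distance exactly `n - i` from the target; this is
what later makes the vertices distinct. -/
theorem StepsTo.exists_geodesic {X : Set (HalfEdge E)} {t : V} (a₀ : HalfEdge E) :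
    ∀ (n : ℕ) (v : V), G.StepsTo X t n v → (∀ m < n, ¬ G.StepsTo X t m v) →
      ∃ (c : ℕ → HalfEdge E) (p : ℕ → V), p 0 = v ∧ p n = t ∧
        (∀ i < n, c i ∈ X ∧ G.tail (c i) = p i ∧ G.head (c i) = p (i + 1)) ∧
        ∀ i ≤ n, G.StepsTo X t (n - i) (p i) ∧ ∀ m < n - i, ¬ G.StepsTo X t m (p i) := by
  intro n
  induction n with
  | zero =>
    intro v hv hmin
    -- `a₀` only fills the sequence beyond the end of the walk.
    refine ⟨fun _ => a₀, fun _ => v, rfl, hv, by simp, ?_⟩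
    intro i _
    simp only [Nat.zero_sub]
    exact ⟨hv, by simp⟩
  | succ n ih =>
    rintro v ⟨a, ha, rfl, hn⟩ hmin
    obtain ⟨c, p, hp0, hpn, hc, hp⟩ := ih (G.head a) hn
      (fun m hm h => hmin (m + 1) (by omega) ⟨a, ha, rfl, h⟩)
    refine ⟨fun i => Nat.casesOn i a c, fun i => Nat.casesOn i (G.tail a) p, rfl, hpn, ?_, ?_⟩
    · rintro (_ | i) hi
      · exact ⟨ha, rfl, hp0.symm⟩
      · exact hc i (by omega)
    · rintro (_ | i) hi
      · exact ⟨⟨a, ha, rfl, hn⟩, hmin⟩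
      · simpa using hp i (by omega)

/-- A shortest walk from the head of `a` back to its tail, closed up by `a`. The assumption `a.rev ∉
X` excludes the closed walk that goes along `a` and straight back, the only way an edge could
repeat. -/
theorem DReach.exists_isDirectedCycle {X : Set (HalfEdge E)} {a : HalfEdge E} (ha : a.rev ∉ X)
    (h : G.DReach X (G.head a) (G.tail a)) :
    ∃ C, G.IsDirectedCycle C ∧ a ∈ C ∧ C ⊆ insert a X := by
  classical
  have hex := h.exists_stepsTo
  obtain ⟨c, p, hp0, hpn, hc, hp⟩ := StepsTo.exists_geodesic a (Nat.find hex) _ (Nat.find_spec hex)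
    (fun m hm => Nat.find_min hex hm)
  generalize Nat.find hex = n at *
  have hinj : ∀ i ≤ n, ∀ j ≤ n, p i = p j → i = j := by
    intro i hi j hj hij
    by_contra hne
    rcases lt_or_gt_of_ne hne with hlt | hlt
    · exact (hp i hi).2 (n - j) (by omega) (hij ▸ (hp j hj).1)
    · exact (hp j hj).2 (n - i) (by omega) (hij ▸ (hp i hi).1)
  let d : ℕ → HalfEdge E := fun i => if i < n then c i else a
  have hdt : ∀ i ≤ n, G.tail (d i) = p i := by
    intro i hi
    by_cases hin : i < n
    · simp only [d, if_pos hin, (hc i hin).2.1]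
    · obtain rfl : i = n := by omega
      simp only [d, if_neg hin, hpn]
  have hdh : ∀ i < n, G.head (d i) = p (i + 1) := by
    intro i hi
    simp only [d, if_pos hi, (hc i hi).2.2]
  have hdn : d n = a := by simp [d]
  have hdX : ∀ i, d i ∈ insert a X := by
    intro i
    by_cases hin : i < n
    · simp only [d, if_pos hin]
      exact Or.inr (hc i hin).1
    · simp only [d, if_neg hin]
      exact Or.inl rfl
  have harev : a.rev ∉ insert a X := by
    rintro (h' | h')
    · exact rev_ne a h'
    · exact ha h'
  have hval : ∀ i : Fin (n + 1), (i : ℕ) < n → ((i + 1 : Fin (n + 1)) : ℕ) = i + 1 := by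
    intro i hi
    rw [Fin.val_add_one_of_lt']
    omega
  have hhead : ∀ i : Fin (n + 1), G.head (d i) = G.tail (d (i + 1 : Fin (n + 1))) := by
    intro i
    rcases Nat.lt_or_ge (i : ℕ) n with hi | hi
    · rw [hdh _ hi, hval i hi, hdt _ (by omega)]
    · obtain rfl : i = Fin.last n := Fin.ext (by simp; omega)
      simp only [Fin.val_last, hdn, Fin.last_add_one, Fin.val_zero]
      rw [hdt 0 (Nat.zero_le _), hp0]
  have htail : Function.Injective fun i : Fin (n + 1) => G.tail (d i) := by
    intro i j hij
    simp only [hdt _ (Nat.le_of_lt_succ i.2), hdt _ (Nat.le_of_lt_succ j.2)] at hij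
    exact Fin.ext (hinj _ (by omega) _ (by omega) hij)
  have hedge : Function.Injective fun i : Fin (n + 1) => (d i).1 := by
    intro i j hij
    rcases eq_or_eq_rev hij with h' | h'
    · exact htail (congrArg G.tail h')
    · exfalso
      -- Two opposite arcs of the closed walk each follow the other cyclically, so the walk has
      -- length at most two.
      have h1 : i = j + 1 := htail (by
        change G.tail (d i) = G.tail (d (j + 1 : Fin (n + 1)))
        rw [h', tail_rev, hhead j])
      have h2 : j = i + 1 := htail (by
        change G.tail (d j) = G.tail (d (i + 1 : Fin (n + 1)))
        rw [← hhead i, h', head_rev])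
      have key : ∀ k l : Fin (n + 1), l = k + 1 → k = l + 1 → (k : ℕ) < n → d k = (d l).rev →
          False := by
        intro k l hl hk hkn hkl
        have hlk : (l : ℕ) = k + 1 := by rw [hl, hval k hkn]
        by_cases hln : (l : ℕ) < n
        · have := hval l hln
          rw [← hk] at this
          omega
        · have : (l : ℕ) = n := by omega
          rw [this, hdn] at hkl
          exact harev (hkl ▸ hdX k)
      by_cases hin : (i : ℕ) < n
      · exact key i j h2 h1 hin h'
      · by_cases hjn : (j : ℕ) < n
        · exact key j i h1 h2 hjn (by rw [h', rev_rev])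
        · have : (i : ℕ) = j := by omega
          rw [this] at h'
          exact rev_ne _ h'.symm
  refine ⟨Set.range fun i : Fin (n + 1) => d i, ⟨n, fun i => d i, hhead, htail, hedge, rfl⟩,
    ⟨Fin.last n, hdn⟩, ?_⟩
  rintro _ ⟨i, rfl⟩
  exact hdX i

end CycleExtraction

/-! ### Cuts and the cocycles contained in them. -/

section Cuts

theorem mem_outCut {S : Set V} {a : HalfEdge E} :
    a ∈ G.outCut S ↔ G.tail a ∈ S ∧ G.head a ∉ S := Iff.rfl

theorem revArcs_outCut (S : Set V) : revArcs (G.outCut S) = G.outCut Sᶜ := by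
  ext a
  simp [mem_outCut, and_comm]

theorem mem_arcEdges_outCut {S : Set V} {a : HalfEdge E} :
    a.1 ∈ arcEdges (G.outCut S) ↔ ¬ (G.tail a ∈ S ↔ G.head a ∈ S) := by
  rw [mem_arcEdges, mem_outCut, mem_outCut, tail_rev, head_rev]
  tauto

theorem IsDirectedCocycle.revArcs {C : Set (HalfEdge E)} (h : G.IsDirectedCocycle C) :
    G.IsDirectedCocycle (revArcs C) := by
  obtain ⟨⟨a, ha⟩, S, rfl, hS⟩ := h
  refine ⟨⟨a.rev, by simpa using ha⟩, Sᶜ, revArcs_outCut S, ?_⟩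
  rwa [arcEdges_revArcs]

/-- Among the directed cuts that contain `a` and lie in the given one, a minimal one is a bond: a
cut on fewer edges could be intersected and united with it to give directed cuts that are no larger
and still contain `a`. -/
theorem exists_isDirectedCocycle [Finite E] {S : Set V} {a : HalfEdge E} (ha : a ∈ G.outCut S) :
    ∃ C, G.IsDirectedCocycle C ∧ a ∈ C ∧ C ⊆ G.outCut S := by
  have hfin : Set.Finite {C | ∃ S', C = G.outCut S' ∧ a ∈ C ∧ C ⊆ G.outCut S} := Set.toFinite _
  obtain ⟨C, hC⟩ := hfin.exists_minimal ⟨_, S, rfl, ha, subset_rfl⟩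
  obtain ⟨⟨S', rfl, haC, hCS⟩, hmin⟩ := hC
  refine ⟨_, ⟨⟨a, haC⟩, S', rfl, ?_⟩, haC, hCS⟩
  have main : ∀ S'' : Set V, (G.outCut S'').Nonempty →
      arcEdges (G.outCut S'') ⊆ arcEdges (G.outCut S') → G.tail a ∈ S'' →
      arcEdges (G.outCut S'') = arcEdges (G.outCut S') := by
    intro S'' hne hsub htail
    have hsub' : ∀ b : HalfEdge E, ¬ (G.tail b ∈ S'' ↔ G.head b ∈ S'') →
        ¬ (G.tail b ∈ S' ↔ G.head b ∈ S') :=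
      fun b hb => mem_arcEdges_outCut.1 (hsub (mem_arcEdges_outCut.2 hb))
    have step : ∀ W : Set V, a ∈ G.outCut W → G.outCut W ⊆ G.outCut S' →
        G.outCut W = G.outCut S' := fun W h1 h2 =>
      h2.antisymm (hmin ⟨W, rfl, h1, h2.trans hCS⟩ h2)
    rw [mem_outCut] at haC
    have h1 : G.outCut (S' ∩ S'') = G.outCut S' := by
      refine step _ ⟨⟨haC.1, htail⟩, fun h => haC.2 h.1⟩ ?_
      intro b hb
      have := hsub' b
      simp only [mem_outCut, Set.mem_inter_iff] at hb ⊢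
      tauto
    by_cases hh : G.head a ∈ S''
    · exfalso
      -- If `a` does not cross `S''`, the two equalities `h1` and `h2` put both ends of every arc of
      -- the minimal cut into `S''`, so the cut of `S''` would be empty.
      have h2 : G.outCut (S' ∪ S''ᶜ) = G.outCut S' := by
        refine step _ ⟨Or.inl haC.1, by simp [haC.2, hh]⟩ ?_
        intro b hb
        have := hsub' b
        simp only [mem_outCut, Set.mem_union, Set.mem_compl_iff] at hb ⊢
        tauto
      obtain ⟨b, hb⟩ := hne
      have key : ∀ c : HalfEdge E, c ∈ G.outCut S' → G.tail c ∈ S'' ∧ G.head c ∈ S'' := by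
        intro c hc
        have e1 : c ∈ G.outCut (S' ∩ S'') := h1 ▸ hc
        have e2 : c ∈ G.outCut (S' ∪ S''ᶜ) := h2 ▸ hc
        simp only [mem_outCut, Set.mem_union, Set.mem_compl_iff, Set.mem_inter_iff] at e1 e2
        tauto
      rcases mem_arcEdges.1 (hsub ⟨b, hb, rfl⟩) with h3 | h3
      · exact hb.2 (key _ h3).2
      · have := (key _ h3).1
        rw [tail_rev] at this
        exact hb.2 this
    · have h2 : G.outCut (S' ∪ S'') = G.outCut S' := by
        refine step _ ⟨Or.inl haC.1, by simp [haC.2, hh]⟩ ?_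
        intro b hb
        have := hsub' b
        simp only [mem_outCut, Set.mem_union] at hb ⊢
        tauto
      refine hsub.antisymm (arcEdges_mono ?_)
      intro c hc
      have e1 : c ∈ G.outCut (S' ∩ S'') := h1 ▸ hc
      have e2 : c ∈ G.outCut (S' ∪ S'') := h2 ▸ hc
      simp only [mem_outCut, Set.mem_union, Set.mem_inter_iff] at e1 e2 ⊢
      tauto
  intro S'' hne hsub
  by_cases htail : G.tail a ∈ S''
  · exact main S'' hne hsub htail
  · have := main S''ᶜ
    rw [← revArcs_outCut, arcEdges_revArcs] at this
    refine this ?_ hsub htail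
    obtain ⟨b, hb⟩ := hne
    exact ⟨b.rev, by simpa using hb⟩

end Cuts

end Multigraph

/-! ### Antisymmetric chains of arc sets and of pairs of orientations. -/

section Chains

variable {E : Type*}

open Classical in
/-- The indicator function of a set of arcs. -/
noncomputable def arcInd (X : Set (HalfEdge E)) (a : HalfEdge E) : ℤ := if a ∈ X then 1 else 0

/-- The antisymmetric chain that takes the value `1` on the arcs in `X`. -/
noncomputable def arcChain (X : Set (HalfEdge E)) (a : HalfEdge E) : ℤ :=
  arcInd X a - arcInd X a.rev

theorem arcInd_of_mem {X : Set (HalfEdge E)} {a : HalfEdge E} (h : a ∈ X) : arcInd X a = 1 :=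
  if_pos h

theorem arcInd_of_not_mem {X : Set (HalfEdge E)} {a : HalfEdge E} (h : a ∉ X) :
    arcInd X a = 0 := if_neg h

theorem arcChain_rev (X : Set (HalfEdge E)) (a : HalfEdge E) :
    arcChain X a.rev = - arcChain X a := by
  simp [arcChain]

theorem arcChain_union {X Y : Set (HalfEdge E)} (h : Disjoint X Y) (a : HalfEdge E) :
    arcChain (X ∪ Y) a = arcChain X a + arcChain Y a := by
  have h1 : a ∈ X → a ∉ Y := fun h' => Set.disjoint_left.1 h h'
  have h2 : a.rev ∈ X → a.rev ∉ Y := fun h' => Set.disjoint_left.1 h h'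
  by_cases e1 : a ∈ X <;> by_cases e2 : a ∈ Y <;> by_cases e3 : a.rev ∈ X <;>
    by_cases e4 : a.rev ∈ Y <;> simp_all [arcChain, arcInd]

theorem arcChain_diff {X C : Set (HalfEdge E)} (h : C ⊆ X) (a : HalfEdge E) :
    arcChain (X \ C) a = arcChain X a - arcChain C a := by
  have := arcChain_union (X := X \ C) (Y := C) Set.disjoint_sdiff_left a
  rw [Set.sdiff_union_of_subset h] at this
  omega

@[simp] theorem arcChain_empty (a : HalfEdge E) : arcChain (∅ : Set (HalfEdge E)) a = 0 := by
  simp [arcChain, arcInd]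

theorem arcChain_eq_one {X : Set (HalfEdge E)} (h : ∀ a ∈ X, a.rev ∉ X) {a : HalfEdge E} :
    arcChain X a = 1 ↔ a ∈ X := by
  have := h a
  by_cases e1 : a ∈ X <;> by_cases e3 : a.rev ∈ X <;> simp_all [arcChain, arcInd]

theorem arcChain_eq_zero {X : Set (HalfEdge E)} (h : ∀ a ∈ X, a.rev ∉ X) {a : HalfEdge E} :
    arcChain X a = 0 ↔ a.1 ∉ arcEdges X := by
  have := h a
  rw [mem_arcEdges]
  by_cases e1 : a ∈ X <;> by_cases e3 : a.rev ∈ X <;> simp_all [arcChain, arcInd]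

theorem arcChain_injective {X Y : Set (HalfEdge E)} (hX : ∀ a ∈ X, a.rev ∉ X)
    (hY : ∀ a ∈ Y, a.rev ∉ Y) (h : ∀ a, arcChain X a = arcChain Y a) : X = Y := by
  ext a
  rw [← arcChain_eq_one hX, ← arcChain_eq_one hY, h]

theorem eq_arcChain {c : HalfEdge E → ℤ} (hc : ∀ a, c a.rev = - c a)
    (h : ∀ a, c a = -1 ∨ c a = 0 ∨ c a = 1) (a : HalfEdge E) :
    c a = arcChain {b | c b = 1} a := by
  have := hc a
  rcases h a with h' | h' | h' <;> rw [h'] at this <;> simp [arcChain, arcInd, h', this]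

/-- The difference of the indicator functions of two orientations. -/
noncomputable def EdgeOrientation.diffChain (O O' : EdgeOrientation E) (a : HalfEdge E) : ℤ :=
  arcInd O.arcs a - arcInd O'.arcs a

namespace EdgeOrientation

theorem diffChain_eq_arcChain (O O' : EdgeOrientation E) (a : HalfEdge E) :
    O.diffChain O' a = arcChain (O.arcs \ O'.arcs) a := by
  have h1 := O.rev_mem_arcs a
  have h2 := O'.rev_mem_arcs a
  by_cases e1 : a ∈ O.arcs <;> by_cases e2 : a ∈ O'.arcs <;>
    simp_all [arcChain, arcInd, diffChain]

theorem rev_not_mem_diff (O O' : EdgeOrientation E) :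
    ∀ a ∈ O.arcs \ O'.arcs, a.rev ∉ O.arcs \ O'.arcs :=
  fun _ ha => O.rev_not_mem_of_subset Set.sdiff_subset ha

theorem diffChain_eq_one {O O' : EdgeOrientation E} {a : HalfEdge E} :
    O.diffChain O' a = 1 ↔ a ∈ O.arcs ∧ a ∉ O'.arcs := by
  rw [diffChain_eq_arcChain, arcChain_eq_one (O.rev_not_mem_diff O')]
  rfl

theorem diffChain_rev (O O' : EdgeOrientation E) (a : HalfEdge E) :
    O.diffChain O' a.rev = - O.diffChain O' a := by
  simp only [diffChain_eq_arcChain, arcChain_rev]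

theorem diffChain_values (O O' : EdgeOrientation E) (a : HalfEdge E) :
    O.diffChain O' a = -1 ∨ O.diffChain O' a = 0 ∨ O.diffChain O' a = 1 := by
  unfold diffChain arcInd
  split_ifs <;> simp

theorem diffChain_eq_zero {O O' : EdgeOrientation E} {a : HalfEdge E} :
    O.diffChain O' a = 0 ↔ (a ∈ O.arcs ↔ a ∈ O'.arcs) := by
  unfold diffChain arcInd
  split_ifs <;> simp_all

theorem eq_of_diffChain_eq_zero {O O' : EdgeOrientation E} (h : ∀ a, O.diffChain O' a = 0) :
    O = O' :=
  ext_arcs (Set.ext fun a => diffChain_eq_zero.1 (h a))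

end EdgeOrientation

theorem IsReversalOf.diffChain_eq {O O' : EdgeOrientation E} {C : Set (HalfEdge E)}
    (h : IsReversalOf O O' C) (a : HalfEdge E) : O.diffChain O' a = arcChain C a := by
  rw [O.diffChain_eq_arcChain, ← h.diff_eq]

theorem isReversalOf_of_diffChain_eq {O O' : EdgeOrientation E} {C : Set (HalfEdge E)}
    (hC : ∀ a ∈ C, a.rev ∉ C) (h : ∀ a, O.diffChain O' a = arcChain C a) :
    IsReversalOf O O' C := by
  rw [arcChain_injective hC (O.rev_not_mem_diff O')
    fun a => (h a).symm.trans (O.diffChain_eq_arcChain O' a)]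
  exact isReversalOf_diff O O'

theorem IsReversalOf.exists_split {O O' : EdgeOrientation E} {C D : Set (HalfEdge E)}
    (h : IsReversalOf O O' (C ∪ D)) (hCD : Disjoint C D) :
    ∃ O₁, IsReversalOf O O₁ C ∧ IsReversalOf O₁ O' D := by
  obtain ⟨O₁, h₁⟩ := exists_isReversalOf (Set.subset_union_left.trans h.1)
  refine ⟨O₁, h₁, isReversalOf_of_diffChain_eq
    (fun a ha => O.rev_not_mem_of_subset (Set.subset_union_right.trans h.1) ha) fun a => ?_⟩
  have e1 := h.diffChain_eq a
  have e2 := h₁.diffChain_eq a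
  rw [arcChain_union hCD] at e1
  unfold EdgeOrientation.diffChain at *
  omega

/-- Disjoint pieces can be reversed one at a time, since reversing one leaves the others contained
in the orientation. -/
theorem IsReversalOf.eqvGen {r : EdgeOrientation E → EdgeOrientation E → Prop}
    {Piece : Set (HalfEdge E) → Prop}
    (hr : ∀ O O' C, Piece C → IsReversalOf O O' C → r O O') {𝒞 : Set (Set (HalfEdge E))}
    (hfin : 𝒞.Finite) (hP : ∀ C ∈ 𝒞, Piece C) (hd : 𝒞.PairwiseDisjoint id)
    {O O' : EdgeOrientation E} (h : IsReversalOf O O' (⋃₀ 𝒞)) : Relation.EqvGen r O O' := by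
  induction 𝒞, hfin using Set.Finite.induction_on generalizing O with
  | empty =>
    rw [Set.sUnion_empty] at h
    have : O = O' := EdgeOrientation.eq_of_diffChain_eq_zero fun a => by
      rw [h.diffChain_eq, arcChain_empty]
    exact this ▸ Relation.EqvGen.refl _
  | @insert C 𝒞 hC _ ih =>
    rw [Set.sUnion_insert] at h
    obtain ⟨O₁, h₁, h₂⟩ := h.exists_split (by
      rw [Set.disjoint_sUnion_right]
      intro D hD
      exact hd (Set.mem_insert _ _) (Set.mem_insert_of_mem _ hD) (by rintro rfl; exact hC hD))
    exact (Relation.EqvGen.rel _ _ (hr _ _ _ (hP _ (Set.mem_insert _ _)) h₁)).trans _ _ _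
      (ih (fun D hD => hP D (Set.mem_insert_of_mem _ hD))
        (hd.subset (Set.subset_insert _ _)) h₂)

/-- Greedy removal of pieces, common to the cycle and the cocycle decomposition. -/
theorem exists_disjoint_pieces {α : Type*} [Finite α] {Good Piece : Set α → Prop}
    (step : ∀ X, Good X → X.Nonempty → ∃ C ⊆ X, C.Nonempty ∧ Piece C ∧ Good (X \ C))
    {X : Set α} (hX : Good X) :
    ∃ 𝒞 : Set (Set α), (∀ C ∈ 𝒞, Piece C) ∧ 𝒞.PairwiseDisjoint id ∧ ⋃₀ 𝒞 = X := by
  induction h : X.ncard using Nat.strong_induction_on generalizing X with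
  | _ n ih =>
    rcases X.eq_empty_or_nonempty with rfl | hne
    · exact ⟨∅, by simp, by simp, by simp⟩
    · obtain ⟨C, hCX, hCne, hC, hG⟩ := step X hX hne
      have hlt : (X \ C).ncard < n := by
        rw [← h]
        refine Set.ncard_lt_ncard ⟨Set.sdiff_subset, fun hsub => ?_⟩ (Set.toFinite _)
        obtain ⟨a, ha⟩ := hCne
        exact (hsub (hCX ha)).2 ha
      obtain ⟨𝒞, h1, h2, h3⟩ := ih _ hlt hG rfl
      refine ⟨insert C 𝒞, ?_, ?_, ?_⟩
      · rintro D (rfl | hD)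
        · exact hC
        · exact h1 D hD
      · refine h2.insert fun D hD _ => ?_
        have : D ⊆ X \ C := h3 ▸ Set.subset_sUnion_of_mem hD
        exact Set.disjoint_left.2 fun a ha hD' => (this hD').2 ha
      · rw [Set.sUnion_insert, h3, Set.union_sdiff_cancel hCX]

end Chains

/-! ### Flows, tensions and their orthogonality. -/

namespace Multigraph

variable {V E : Type*} {G : Multigraph V E}

/-- An antisymmetric chain that is orthogonal to all coboundaries. -/
def IsFlow [Fintype E] (G : Multigraph V E) (c : HalfEdge E → ℤ) : Prop :=
  (∀ a, c a.rev = - c a) ∧ ∀ y : V → ℤ, ∑ a, c a * y (G.head a) = 0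

/-- The coboundary of a potential. -/
def coboundary (G : Multigraph V E) (y : V → ℤ) (a : HalfEdge E) : ℤ :=
  y (G.head a) - y (G.tail a)

/-- A chain that is the coboundary of some potential. -/
def IsTension (G : Multigraph V E) (d : HalfEdge E → ℤ) : Prop := ∃ y, d = G.coboundary y

theorem coboundary_rev (y : V → ℤ) (a : HalfEdge E) :
    G.coboundary y a.rev = - G.coboundary y a := by
  simp [coboundary]

namespace IsTension

theorem zero : G.IsTension 0 := ⟨0, by ext; simp [coboundary]⟩

theorem add {c d : HalfEdge E → ℤ} (hc : G.IsTension c) (hd : G.IsTension d) :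
    G.IsTension (c + d) := by
  obtain ⟨y, rfl⟩ := hc
  obtain ⟨z, rfl⟩ := hd
  exact ⟨y + z, by ext; simp [coboundary]; ring⟩

theorem neg {c : HalfEdge E → ℤ} (hc : G.IsTension c) : G.IsTension (-c) := by
  obtain ⟨y, rfl⟩ := hc
  exact ⟨-y, by ext; simp [coboundary]; ring⟩

theorem sub {c d : HalfEdge E → ℤ} (hc : G.IsTension c) (hd : G.IsTension d) :
    G.IsTension (c - d) := sub_eq_add_neg c d ▸ hc.add hd.neg

theorem rev {d : HalfEdge E → ℤ} (hd : G.IsTension d) (a : HalfEdge E) : d a.rev = - d a := by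
  obtain ⟨y, rfl⟩ := hd
  exact coboundary_rev y a

end IsTension

namespace IsFlow

variable [Fintype E]

theorem zero : G.IsFlow 0 := ⟨by simp, by simp⟩

theorem add {c d : HalfEdge E → ℤ} (hc : G.IsFlow c) (hd : G.IsFlow d) : G.IsFlow (c + d) := by
  refine ⟨fun a => ?_, fun y => ?_⟩
  · simp only [Pi.add_apply, hc.1, hd.1]; ring
  · simp only [Pi.add_apply, add_mul, Finset.sum_add_distrib, hc.2, hd.2, add_zero]

theorem neg {c : HalfEdge E → ℤ} (hc : G.IsFlow c) : G.IsFlow (-c) := by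
  refine ⟨fun a => ?_, fun y => ?_⟩
  · simp only [Pi.neg_apply, hc.1]
  · simp only [Pi.neg_apply, neg_mul, Finset.sum_neg_distrib, hc.2, neg_zero]

theorem sub {c d : HalfEdge E → ℤ} (hc : G.IsFlow c) (hd : G.IsFlow d) : G.IsFlow (c - d) :=
  sub_eq_add_neg c d ▸ hc.add hd.neg

theorem sum_mul_coboundary {c : HalfEdge E → ℤ} (hc : G.IsFlow c) (y : V → ℤ) :
    ∑ a, c a * G.coboundary y a = 0 := by
  have h : ∑ a, c a * y (G.tail a) = - ∑ a, c a * y (G.head a) := by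
    rw [← Equiv.sum_comp revEquiv fun a => c a * y (G.tail a), ← Finset.sum_neg_distrib]
    refine Finset.sum_congr rfl fun a _ => ?_
    change c a.rev * y (G.tail a.rev) = _
    rw [hc.1, tail_rev, neg_mul]
  simp only [coboundary, mul_sub, Finset.sum_sub_distrib, h, hc.2 y, sub_zero, neg_zero]

theorem sum_mul_eq_zero {c d : HalfEdge E → ℤ} (hc : G.IsFlow c) (hd : G.IsTension d) :
    ∑ a, c a * d a = 0 := by
  obtain ⟨y, rfl⟩ := hd
  exact hc.sum_mul_coboundary y

/-- Such a chain is orthogonal to itself, so its sum of squares is zero. -/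
theorem eq_zero_of_isTension {c : HalfEdge E → ℤ} (hc : G.IsFlow c) (hd : G.IsTension c) :
    c = 0 := by
  have h := hc.sum_mul_eq_zero hd
  rw [Finset.sum_eq_zero_iff_of_nonneg fun a _ => mul_self_nonneg _] at h
  ext a
  exact mul_self_eq_zero.1 (h a (Finset.mem_univ a))

end IsFlow

theorem sum_arcChain_mul_head [Fintype E] (X : Set (HalfEdge E)) (y : V → ℤ) :
    ∑ a, arcChain X a * y (G.head a) = ∑ a, arcInd X a * G.coboundary y a := by
  have h : ∑ a, arcInd X a.rev * y (G.head a) = ∑ a, arcInd X a * y (G.tail a) := by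
    rw [← Equiv.sum_comp revEquiv fun a => arcInd X a * y (G.tail a)]
    refine Finset.sum_congr rfl fun a _ => ?_
    change _ = arcInd X a.rev * y (G.tail a.rev)
    rw [tail_rev]
  simp only [arcChain, coboundary, sub_mul, mul_sub, Finset.sum_sub_distrib, h]

/-- The sum of a coboundary around a closed walk telescopes. -/
theorem IsDirectedCycle.isFlow [Fintype E] {C : Set (HalfEdge E)} (h : G.IsDirectedCycle C) :
    G.IsFlow (arcChain C) := by
  classical
  refine ⟨arcChain_rev C, fun y => ?_⟩
  obtain ⟨n, c, hc, hinj, -, rfl⟩ := h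
  have hinj' : Function.Injective c := fun i j hij => hinj (congrArg G.tail hij)
  rw [sum_arcChain_mul_head]
  have : ∑ a, arcInd (Set.range c) a * G.coboundary y a = ∑ i, G.coboundary y (c i) := by
    rw [← Finset.sum_image (s := Finset.univ) (g := c) (f := G.coboundary y) hinj'.injOn]
    simp only [arcInd, ite_mul, one_mul, zero_mul]
    rw [← Finset.sum_filter]
    refine Finset.sum_congr ?_ fun _ _ => rfl
    ext a
    simp
  rw [this]
  simp only [coboundary, hc, Finset.sum_sub_distrib]
  rw [sub_eq_zero]
  exact Equiv.sum_comp (Equiv.addRight 1) fun i => y (G.tail (c i))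

theorem isTension_outCut (S : Set V) : G.IsTension (arcChain (G.outCut S)) := by
  classical
  -- Arcs leaving `S` must get value `+1`, so the potential is higher outside `S`.
  refine ⟨fun v => if v ∈ S then 0 else 1, ?_⟩
  ext a
  simp only [arcChain, arcInd, coboundary, mem_outCut, tail_rev, head_rev]
  split_ifs <;> simp_all

theorem IsDirectedCocycle.isTension {C : Set (HalfEdge E)} (h : G.IsDirectedCocycle C) :
    G.IsTension (arcChain C) := by
  obtain ⟨-, S, rfl, -⟩ := h
  exact isTension_outCut S

/-- The set of vertices reached from the head of `a` is left by no arc of `X`, so by conservation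
none enters it; `a` would enter it if its tail were not reached. -/
theorem IsFlow.dreach [Fintype E] {X : Set (HalfEdge E)} (h : G.IsFlow (arcChain X))
    {a : HalfEdge E} (ha : a ∈ X) : G.DReach X (G.head a) (G.tail a) := by
  classical
  by_contra hcon
  let y : V → ℤ := fun v => if G.DReach X (G.head a) v then 1 else 0
  have hy := h.2 y
  rw [sum_arcChain_mul_head] at hy
  have hnn : ∀ b ∈ (Finset.univ : Finset (HalfEdge E)), 0 ≤ arcInd X b * G.coboundary y b := by
    intro b _
    by_cases hb : b ∈ X
    · have : G.DReach X (G.head a) (G.tail b) → G.DReach X (G.head a) (G.head b) :=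
        fun h' => h'.tail_step hb
      rw [arcInd_of_mem hb, one_mul]
      simp only [coboundary, y]
      split_ifs <;> simp_all
    · rw [arcInd_of_not_mem hb, zero_mul]
  have := (Finset.sum_eq_zero_iff_of_nonneg hnn).1 hy a (Finset.mem_univ a)
  rw [arcInd_of_mem ha, one_mul] at this
  simp only [coboundary, y, if_neg hcon] at this
  rw [if_pos (show G.DReach X (G.head a) (G.head a) from Relation.ReflTransGen.refl)] at this
  omega

theorem exists_cycle_decomposition [Fintype E] {X : Set (HalfEdge E)}
    (hX : ∀ a ∈ X, a.rev ∉ X) (hf : G.IsFlow (arcChain X)) :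
    ∃ 𝒞 : Set (Set (HalfEdge E)), (∀ C ∈ 𝒞, G.IsDirectedCycle C) ∧ 𝒞.PairwiseDisjoint id ∧
      ⋃₀ 𝒞 = X := by
  refine exists_disjoint_pieces
    (Good := fun X => (∀ a ∈ X, a.rev ∉ X) ∧ G.IsFlow (arcChain X)) ?_ ⟨hX, hf⟩
  rintro X ⟨hX, hf⟩ ⟨a, ha⟩
  obtain ⟨C, hC, haC, hCX⟩ := (hf.dreach ha).exists_isDirectedCycle (hX a ha)
  rw [Set.insert_eq_of_mem ha] at hCX
  refine ⟨C, hCX, ⟨a, haC⟩, hC, fun b hb hb' => hX b hb.1 hb'.1, ?_⟩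
  rw [show arcChain (X \ C) = arcChain X - arcChain C from funext fun b => arcChain_diff hCX b]
  exact hf.sub hC.isFlow

/-- Every arc along which the potential increases is in `X`. A sublevel set of the potential
therefore has its whole directed cut inside `X`, and this cut contains a cocycle to split off. -/
theorem exists_cocycle_decomposition [Finite E] {X : Set (HalfEdge E)}
    (hX : ∀ a ∈ X, a.rev ∉ X) (hf : G.IsTension (arcChain X)) :
    ∃ 𝒞 : Set (Set (HalfEdge E)), (∀ C ∈ 𝒞, G.IsDirectedCocycle C) ∧ 𝒞.PairwiseDisjoint id ∧
      ⋃₀ 𝒞 = X := by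
  refine exists_disjoint_pieces
    (Good := fun X => (∀ a ∈ X, a.rev ∉ X) ∧ G.IsTension (arcChain X)) ?_ ⟨hX, hf⟩
  rintro X ⟨hX, y, hy⟩ ⟨a, ha⟩
  have hval : ∀ b, y (G.tail b) < y (G.head b) → b ∈ X := by
    intro b hb
    have h1 := congrFun hy b
    simp only [coboundary, arcChain, arcInd] at h1
    by_contra hbX
    rw [if_neg hbX] at h1
    split_ifs at h1 <;> omega
  have ha' : y (G.tail a) < y (G.head a) := by
    have h1 := congrFun hy a
    rw [(arcChain_eq_one hX).2 ha, coboundary] at h1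
    omega
  have haS : a ∈ G.outCut {v | y v < y (G.head a)} := ⟨ha', by simp⟩
  obtain ⟨C, hC, haC, hCS⟩ := exists_isDirectedCocycle haS
  have hCX : C ⊆ X := by
    intro b hb
    have := hCS hb
    simp only [mem_outCut, Set.mem_ofPred_eq, not_lt] at this
    exact hval b (by omega)
  refine ⟨C, hCX, ⟨a, haC⟩, hC, fun b hb hb' => hX b hb.1 hb'.1, ?_⟩
  rw [show arcChain (X \ C) = arcChain X - arcChain C from funext fun b => arcChain_diff hCX b]
  exact IsTension.sub ⟨y, hy⟩ hC.isTension

theorem isFlow_sUnion [Fintype E] {𝒞 : Set (Set (HalfEdge E))}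
    (hC : ∀ C ∈ 𝒞, G.IsDirectedCycle C) (hd : 𝒞.PairwiseDisjoint id) :
    G.IsFlow (arcChain (⋃₀ 𝒞)) := by
  induction 𝒞, 𝒞.toFinite using Set.Finite.induction_on with
  | empty =>
    rw [Set.sUnion_empty, show arcChain (∅ : Set (HalfEdge E)) = 0 from funext arcChain_empty]
    exact IsFlow.zero
  | @insert C 𝒞 hmem _ ih =>
    have hdis : Disjoint C (⋃₀ 𝒞) := by
      rw [Set.disjoint_sUnion_right]
      intro D hD
      exact hd (Set.mem_insert _ _) (Set.mem_insert_of_mem _ hD) (by rintro rfl; exact hmem hD)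
    rw [Set.sUnion_insert, show arcChain (C ∪ ⋃₀ 𝒞) = arcChain C + arcChain (⋃₀ 𝒞) from
      funext fun b => arcChain_union hdis b]
    exact (hC _ (Set.mem_insert _ _)).isFlow.add
      (ih (fun D hD => hC D (Set.mem_insert_of_mem _ hD)) (hd.subset (Set.subset_insert _ _)))

theorem isTension_sUnion [Finite E] {𝒞 : Set (Set (HalfEdge E))}
    (hC : ∀ C ∈ 𝒞, G.IsDirectedCocycle C) (hd : 𝒞.PairwiseDisjoint id) :
    G.IsTension (arcChain (⋃₀ 𝒞)) := by
  induction 𝒞, 𝒞.toFinite using Set.Finite.induction_on with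
  | empty =>
    rw [Set.sUnion_empty, show arcChain (∅ : Set (HalfEdge E)) = 0 from funext arcChain_empty]
    exact IsTension.zero
  | @insert C 𝒞 hmem _ ih =>
    have hdis : Disjoint C (⋃₀ 𝒞) := by
      rw [Set.disjoint_sUnion_right]
      intro D hD
      exact hd (Set.mem_insert _ _) (Set.mem_insert_of_mem _ hD) (by rintro rfl; exact hmem hD)
    rw [Set.sUnion_insert, show arcChain (C ∪ ⋃₀ 𝒞) = arcChain C + arcChain (⋃₀ 𝒞) from
      funext fun b => arcChain_union hdis b]
    exact (hC _ (Set.mem_insert _ _)).isTension.add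
      (ih (fun D hD => hC D (Set.mem_insert_of_mem _ hD)) (hd.subset (Set.subset_insert _ _)))

/-- If two orientations differ by the sum of a flow and a tension, then the two chains have disjoint
supports. -/
theorem disjoint_supports [Fintype E] {O O' : EdgeOrientation E} {c d : HalfEdge E → ℤ}
    (hc : G.IsFlow c) (hd : G.IsTension d) (h : ∀ a, O.diffChain O' a = c a + d a)
    (a : HalfEdge E) : d a = 0 ∨ c a = 0 := by
  have hnn : ∀ b ∈ (Finset.univ : Finset (HalfEdge E)), 0 ≤ -(c b * d b) := by
    intro b _
    have : c b = O.diffChain O' b - d b := by rw [h]; ring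
    rw [this]
    -- With `e` the value of the difference chain, the term is `d ^ 2 - e * d`, which is nonnegative
    -- for integers as `|e| ≤ 1`.
    rcases lt_trichotomy (d b) 0 with h' | h' | h'
    · rcases O.diffChain_values O' b with e | e | e <;> rw [e] <;> nlinarith
    · simp [h']
    · rcases O.diffChain_values O' b with e | e | e <;> rw [e] <;> nlinarith
  have hsum : ∑ b, -(c b * d b) = 0 := by
    rw [Finset.sum_neg_distrib, hc.sum_mul_eq_zero hd, neg_zero]
  have := (Finset.sum_eq_zero_iff_of_nonneg hnn).1 hsum a (Finset.mem_univ a)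
  rw [neg_eq_zero, mul_eq_zero] at this
  exact this.symm

end Multigraph

/-! ### Reversal classes in terms of flows and tensions. -/

namespace Multigraph

variable {V E : Type*} {G : Multigraph V E}

theorem diffChain_of_eqvGen {r : EdgeOrientation E → EdgeOrientation E → Prop}
    {P : (HalfEdge E → ℤ) → Prop} (h0 : P 0) (hneg : ∀ c, P c → P (-c))
    (hadd : ∀ c d, P c → P d → P (c + d))
    (hr : ∀ O O', r O O' → P (O.diffChain O')) {O O' : EdgeOrientation E}
    (h : Relation.EqvGen r O O') : P (O.diffChain O') := by
  induction h with
  | rel _ _ h => exact hr _ _ h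
  | refl O =>
    rwa [show O.diffChain O = 0 from funext fun a => by simp [EdgeOrientation.diffChain]]
  | symm O O' _ ih =>
    rw [show O'.diffChain O = - O.diffChain O' from
      funext fun a => by simp [EdgeOrientation.diffChain]]
    exact hneg _ ih
  | trans O O' O'' _ _ ih ih' =>
    rw [show O.diffChain O'' = O.diffChain O' + O'.diffChain O'' from
      funext fun a => by simp [EdgeOrientation.diffChain]]
    exact hadd _ _ ih ih'

theorem cycleSetoid_iff [Fintype E] {O O' : EdgeOrientation E} :
    G.cycleSetoid O O' ↔ G.IsFlow (O.diffChain O') := by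
  constructor
  · refine fun h => diffChain_of_eqvGen IsFlow.zero (fun _ => IsFlow.neg) (fun _ _ => IsFlow.add)
      ?_ h
    rintro O O' ⟨C, hC, hr⟩
    rw [show O.diffChain O' = arcChain C from funext hr.diffChain_eq]
    exact hC.isFlow
  · intro h
    rw [show O.diffChain O' = _ from funext (O.diffChain_eq_arcChain O')] at h
    obtain ⟨𝒞, hC, hd, hU⟩ := exists_cycle_decomposition (O.rev_not_mem_diff O') h
    exact IsReversalOf.eqvGen (Piece := G.IsDirectedCycle) (fun _ _ C hC hr => ⟨C, hC, hr⟩)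
      𝒞.toFinite hC hd (hU ▸ isReversalOf_diff O O')

theorem cocycleSetoid_iff [Finite E] {O O' : EdgeOrientation E} :
    G.cocycleSetoid O O' ↔ G.IsTension (O.diffChain O') := by
  constructor
  · refine fun h => diffChain_of_eqvGen IsTension.zero (fun _ => IsTension.neg)
      (fun _ _ => IsTension.add) ?_ h
    rintro O O' ⟨C, hC, hr⟩
    rw [show O.diffChain O' = arcChain C from funext hr.diffChain_eq]
    exact hC.isTension
  · intro h
    rw [show O.diffChain O' = _ from funext (O.diffChain_eq_arcChain O')] at h
    obtain ⟨𝒞, hC, hd, hU⟩ := exists_cocycle_decomposition (O.rev_not_mem_diff O') h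
    exact IsReversalOf.eqvGen (Piece := G.IsDirectedCocycle) (fun _ _ C hC hr => ⟨C, hC, hr⟩)
      𝒞.toFinite hC hd (hU ▸ isReversalOf_diff O O')

/-- The orientation `O'` is obtained from `O` by reversing a set `X` of arcs that is a directed flow
and a disjoint set `Y` of arcs that is a directed tension. -/
structure IsSplitReversal [Fintype E] (G : Multigraph V E) (O O' : EdgeOrientation E)
    (X Y : Set (HalfEdge E)) : Prop where
  left_subset : X ⊆ O.arcs
  right_subset : Y ⊆ O.arcs
  disjoint : Disjoint X Y
  isFlow : G.IsFlow (arcChain X)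
  isTension : G.IsTension (arcChain Y)
  reversal : IsReversalOf O O' (X ∪ Y)

section Split

variable [Fintype E] {O O' : EdgeOrientation E} {X Y : Set (HalfEdge E)}

theorem DifferBy.isSplitReversal {𝒞 𝒟 : Set (Set (HalfEdge E))} (h : G.DifferBy O O' 𝒞 𝒟) :
    G.IsSplitReversal O O' (⋃₀ 𝒞) (⋃₀ 𝒟) where
  left_subset := Set.subset_union_left.trans h.reversal.1
  right_subset := Set.subset_union_right.trans h.reversal.1
  disjoint := by
    rw [Set.disjoint_sUnion_left]
    intro C hC
    rw [Set.disjoint_sUnion_right]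
    exact fun D hD => h.disjoint C hC D hD
  isFlow := isFlow_sUnion h.cycles h.disjoint_cycles
  isTension := isTension_sUnion h.cocycles h.disjoint_cocycles
  reversal := h.reversal

namespace IsSplitReversal

variable (h : G.IsSplitReversal O O' X Y)

include h

theorem exists_differBy : ∃ 𝒞 𝒟, G.DifferBy O O' 𝒞 𝒟 ∧ ⋃₀ 𝒞 = X ∧ ⋃₀ 𝒟 = Y := by
  obtain ⟨𝒞, hC, hCd, rfl⟩ := exists_cycle_decomposition
    (fun a ha => O.rev_not_mem_of_subset h.left_subset ha) h.isFlow
  obtain ⟨𝒟, hD, hDd, rfl⟩ := exists_cocycle_decomposition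
    (fun a ha => O.rev_not_mem_of_subset h.right_subset ha) h.isTension
  exact ⟨𝒞, 𝒟, ⟨hC, hD, hCd, hDd, fun C hC' D hD' =>
    h.disjoint.mono (Set.subset_sUnion_of_mem hC') (Set.subset_sUnion_of_mem hD'), h.reversal⟩,
    rfl, rfl⟩

theorem diffChain_eq : O.diffChain O' = arcChain X + arcChain Y :=
  funext fun a => by rw [h.reversal.diffChain_eq, arcChain_union h.disjoint]; rfl

theorem rev_not_mem_left : ∀ a ∈ X, a.rev ∉ X :=
  fun _ ha => O.rev_not_mem_of_subset h.left_subset ha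

theorem rev_not_mem_right : ∀ a ∈ Y, a.rev ∉ Y :=
  fun _ ha => O.rev_not_mem_of_subset h.right_subset ha

theorem disjoint_arcEdges : Disjoint (arcEdges X) (arcEdges Y) := by
  rw [Set.disjoint_left]
  rintro _ ⟨a, ha, rfl⟩ hY
  rcases mem_arcEdges.1 hY with h' | h'
  · exact Set.disjoint_left.1 h.disjoint ha h'
  · exact (O.rev_mem_arcs a).1 (h.right_subset h') (h.left_subset ha)

theorem cycleCocycleSetoid : G.cycleCocycleSetoid O O' := by
  obtain ⟨𝒞, 𝒟, hd, rfl, rfl⟩ := h.exists_differBy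
  refine IsReversalOf.eqvGen (Piece := fun C => G.IsDirectedCycle C ∨ G.IsDirectedCocycle C)
    (𝒞 := 𝒞 ∪ 𝒟) ?_ (Set.toFinite _) ?_ ?_ ?_
  · rintro O O' C (hC | hC) hr
    · exact Or.inl ⟨C, hC, hr⟩
    · exact Or.inr ⟨C, hC, hr⟩
  · rintro C (hC | hC)
    · exact Or.inl (hd.cycles C hC)
    · exact Or.inr (hd.cocycles C hC)
  · exact Set.pairwiseDisjoint_union.2
      ⟨hd.disjoint_cycles, hd.disjoint_cocycles, fun C hC D hD _ => hd.disjoint C hC D hD⟩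
  · rw [Set.sUnion_union]
    exact hd.reversal

theorem unique {X' Y' : Set (HalfEdge E)} (h' : G.IsSplitReversal O O' X' Y') :
    X = X' ∧ Y = Y' := by
  have e := h.diffChain_eq.symm.trans h'.diffChain_eq
  have e1 : arcChain X - arcChain X' = arcChain Y' - arcChain Y := by
    rw [sub_eq_sub_iff_add_eq_add, e, add_comm]
  have e2 : arcChain X - arcChain X' = 0 :=
    (h.isFlow.sub h'.isFlow).eq_zero_of_isTension (e1 ▸ h'.isTension.sub h.isTension)
  have e3 : arcChain Y' - arcChain Y = 0 := e1 ▸ e2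
  exact ⟨arcChain_injective h.rev_not_mem_left h'.rev_not_mem_left (congrFun (sub_eq_zero.1 e2)),
    arcChain_injective h.rev_not_mem_right h'.rev_not_mem_right
      (congrFun (sub_eq_zero.1 e3).symm)⟩

end IsSplitReversal

/-- By `disjoint_supports` each of `c` and `d` agrees with the difference chain on its own support,
so it is the chain of the arcs where it equals `1`, and those arcs lie in `O`. -/
theorem exists_isSplitReversal {c d : HalfEdge E → ℤ} (hc : G.IsFlow c) (hd : G.IsTension d)
    (h : O.diffChain O' = c + d) :
    ∃ X Y, G.IsSplitReversal O O' X Y ∧ arcChain X = c ∧ arcChain Y = d := by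
  have h' : ∀ a, O.diffChain O' a = c a + d a := congrFun h
  have hs := disjoint_supports hc hd h'
  have hval := O.diffChain_values O'
  have hcX : ∀ a, c a = arcChain {b | c b = 1} a := eq_arcChain hc.1 fun a => by
    have := hval a
    rw [h'] at this
    rcases hs a with e | e <;> rw [e] at this <;> omega
  have hdY : ∀ a, d a = arcChain {b | d b = 1} a := eq_arcChain hd.rev fun a => by
    have := hval a
    rw [h'] at this
    rcases hs a with e | e <;> rw [e] at this <;> omega
  have hcX' := funext hcX
  have hdY' := funext hdY
  have hdisj : Disjoint {b | c b = 1} {b | d b = 1} := by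
    rw [Set.disjoint_left]
    intro a h1 h2
    simp only [Set.mem_ofPred_eq] at h1 h2
    rcases hs a with e | e <;> omega
  have hX : ∀ a ∈ {b | c b = 1}, a ∈ O.arcs ∧ a ∉ O'.arcs := by
    intro a ha
    simp only [Set.mem_ofPred_eq] at ha
    rw [← EdgeOrientation.diffChain_eq_one, h', ha]
    rcases hs a with e | e <;> omega
  have hY : ∀ a ∈ {b | d b = 1}, a ∈ O.arcs ∧ a ∉ O'.arcs := by
    intro a ha
    simp only [Set.mem_ofPred_eq] at ha
    rw [← EdgeOrientation.diffChain_eq_one, h', ha]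
    rcases hs a with e | e <;> omega
  refine ⟨{b | c b = 1}, {b | d b = 1}, ⟨fun a ha => (hX a ha).1, fun a ha => (hY a ha).1, hdisj,
    hcX' ▸ hc, hdY' ▸ hd, ?_⟩, hcX'.symm, hdY'.symm⟩
  refine isReversalOf_of_diffChain_eq ?_ fun a => by rw [h', arcChain_union hdisj, ← hcX, ← hdY]
  refine fun a ha => O.rev_not_mem_of_subset ?_ ha
  exact Set.union_subset (fun a ha => (hX a ha).1) fun a ha => (hY a ha).1

theorem cycleCocycleSetoid_iff :
    G.cycleCocycleSetoid O O' ↔ ∃ X Y, G.IsSplitReversal O O' X Y := by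
  constructor
  · intro h
    have : ∃ c d, G.IsFlow c ∧ G.IsTension d ∧ O.diffChain O' = c + d := by
      refine diffChain_of_eqvGen (P := fun e => ∃ c d, G.IsFlow c ∧ G.IsTension d ∧ e = c + d)
        ⟨0, 0, IsFlow.zero, IsTension.zero, by simp⟩ ?_ ?_ ?_ h
      · rintro _ ⟨c, d, hc, hd, rfl⟩
        exact ⟨-c, -d, hc.neg, hd.neg, by ring⟩
      · rintro _ _ ⟨c, d, hc, hd, rfl⟩ ⟨c', d', hc', hd', rfl⟩
        exact ⟨c + c', d + d', hc.add hc', hd.add hd', by ring⟩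
      · rintro O O' (⟨C, hC, hr⟩ | ⟨C, hC, hr⟩)
        · exact ⟨_, 0, hC.isFlow, IsTension.zero, by rw [add_zero]; exact funext hr.diffChain_eq⟩
        · exact ⟨0, _, IsFlow.zero, hC.isTension, by rw [zero_add]; exact funext hr.diffChain_eq⟩
    obtain ⟨c, d, hc, hd, e⟩ := this
    obtain ⟨X, Y, hs, -, -⟩ := exists_isSplitReversal hc hd e
    exact ⟨X, Y, hs⟩
  · rintro ⟨X, Y, h⟩
    exact h.cycleCocycleSetoid

end Split

end Multigraph

/-! ### Fundamental cuts of spanning trees and cocycle signatures. -/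

namespace Multigraph

variable {V E : Type*} {G : Multigraph V E}

theorem reach_iff_of_crossing {T : Set E} {S : Set V}
    (hS : ∀ b : HalfEdge E, b.1 ∈ T → (G.tail b ∈ S ↔ G.head b ∈ S)) {u v : V}
    (h : G.Reach T u v) : u ∈ S ↔ v ∈ S := by
  constructor
  · intro hu
    by_contra hv
    obtain ⟨b, hb, h1, h2⟩ := h.exists_exit hu hv
    exact h2 ((hS b hb).1 h1)
  · intro hv
    by_contra hu
    obtain ⟨b, hb, h1, h2⟩ := h.symm.exists_exit hv hu
    exact h2 ((hS b hb).1 h1)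

/-- No edge leaves the set of vertices on which `S` and `S'` agree, and the tail of an arc of the
common cut belongs to it. -/
theorem Connected.eq_of_outCut_eq (hG : G.Connected) {S S' : Set V}
    (hne : (G.outCut S).Nonempty) (h : G.outCut S = G.outCut S') : S = S' := by
  obtain ⟨a, ha⟩ := hne
  have ha' : a ∈ G.outCut S' := h ▸ ha
  ext v
  have key : G.tail a ∈ {v | v ∈ S ↔ v ∈ S'} ↔ v ∈ {v | v ∈ S ↔ v ∈ S'} := by
    refine reach_iff_of_crossing (fun b _ => ?_) (hG.2 (G.tail a) v)
    have h1 : b ∈ G.outCut S ↔ b ∈ G.outCut S' := by rw [h]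
    have h2 : b.rev ∈ G.outCut S ↔ b.rev ∈ G.outCut S' := by rw [h]
    simp only [mem_outCut, tail_rev, head_rev, Set.mem_ofPred_eq] at h1 h2 ⊢
    tauto
  exact key.1 (iff_of_true ha.1 ha'.1)

/-- The vertices joined to the tail of `a` in `T` without the edge of `a`. -/
def treeSide (G : Multigraph V E) (T : Set E) (a : HalfEdge E) : Set V :=
  {w | G.Reach (T \ {a.1}) (G.tail a) w}

theorem tail_mem_treeSide (T : Set E) (a : HalfEdge E) : G.tail a ∈ G.treeSide T a :=
  Relation.ReflTransGen.refl

theorem treeSide_crossing {T : Set E} {a b : HalfEdge E} (hb : b.1 ∈ T) (hab : b.1 ≠ a.1) :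
    G.tail b ∈ G.treeSide T a ↔ G.head b ∈ G.treeSide T a := by
  constructor
  · exact fun h => Reach.tail_step h ⟨hb, hab⟩
  · intro h
    have := Reach.tail_step (a := b.rev) (T := T \ {a.1}) (u := G.tail a) (G := G)
      (by rw [tail_rev]; exact h) ⟨hb, hab⟩
    rwa [head_rev] at this

theorem arcEdges_outCut_treeSide {T : Set E} {a : HalfEdge E} :
    arcEdges (G.outCut (G.treeSide T a)) ⊆ Tᶜ ∪ {a.1} := by
  refine arcEdges_subset_iff.2 fun b hb => ?_
  by_contra hcon
  simp only [Set.mem_union, Set.mem_compl_iff, Set.mem_singleton_iff, not_or, not_not] at hcon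
  exact hb.2 ((treeSide_crossing hcon.1 hcon.2).1 hb.1)

namespace IsSpanningTree

variable {T : Set E} (hT : G.IsSpanningTree T) {a : HalfEdge E}

include hT

theorem head_not_mem_treeSide (ha : a.1 ∈ T) : G.head a ∉ G.treeSide T a := by
  intro h
  obtain ⟨C, hC, -, hCX⟩ := DReach.exists_isDirectedCycle (X := {b | b.1 ∈ T \ {a.1}}) (a := a)
    (by simp) (Reach.symm h)
  refine hT.1 C hC (arcEdges_subset_iff.2 fun b hb => ?_)
  rcases hCX hb with rfl | h'
  · exact ha
  · exact h'.1

theorem mem_outCut_treeSide (ha : a.1 ∈ T) : a ∈ G.outCut (G.treeSide T a) :=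
  ⟨tail_mem_treeSide T a, hT.head_not_mem_treeSide ha⟩

theorem mem_treeSide_or (v : V) : v ∈ G.treeSide T a ∨ v ∈ G.treeSide T a.rev := by
  have key : G.tail a ∈ G.treeSide T a ∪ G.treeSide T a.rev ↔
      v ∈ G.treeSide T a ∪ G.treeSide T a.rev := by
    refine reach_iff_of_crossing (fun b hb => ?_) (hT.2 (G.tail a) v)
    have h1 := tail_mem_treeSide (G := G) T a
    have h2 := tail_mem_treeSide (G := G) T a.rev
    rw [tail_rev] at h2
    by_cases hab : b.1 = a.1
    · rcases eq_or_eq_rev hab with rfl | rfl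
      · exact iff_of_true (Or.inl h1) (Or.inr h2)
      · rw [tail_rev, head_rev]
        exact iff_of_true (Or.inr h2) (Or.inl h1)
    · have e1 := treeSide_crossing (G := G) hb hab
      have e2 := treeSide_crossing (G := G) (a := a.rev) hb hab
      simp only [Set.mem_union, e1, e2]
  exact key.1 (Or.inl (tail_mem_treeSide T a))

theorem eq_treeSide {S : Set V} (hS : arcEdges (G.outCut S) ⊆ Tᶜ ∪ {a.1})
    (ha : a ∈ G.outCut S) : S = G.treeSide T a := by
  have hcross : ∀ b : HalfEdge E, b.1 ∈ T \ {a.1} → (G.tail b ∈ S ↔ G.head b ∈ S) := by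
    intro b hb
    by_contra hcon
    rcases hS (mem_arcEdges_outCut.2 hcon) with h | h
    · exact h hb.1
    · exact hb.2 h
  ext v
  constructor
  · intro hv
    refine (hT.mem_treeSide_or v).resolve_right fun hr => ha.2 ?_
    exact (reach_iff_of_crossing hcross hr).2 hv
  · exact fun hv => (reach_iff_of_crossing hcross hv).1 ha.1

/-- A cocycle through `a` inside this cut has the same vertex side by `eq_treeSide`, so it is the
whole cut. -/
theorem exists_fundamental_cocycle [Finite E] (ha : a.1 ∈ T) :
    ∃ C, G.IsDirectedCocycle C ∧ a ∈ C ∧ C = G.outCut (G.treeSide T a) := by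
  obtain ⟨C, hC, haC, hsub⟩ := exists_isDirectedCocycle (hT.mem_outCut_treeSide ha)
  refine ⟨C, hC, haC, ?_⟩
  obtain ⟨-, S, rfl, -⟩ := hC
  rw [hT.eq_treeSide ((arcEdges_mono hsub).trans arcEdges_outCut_treeSide) haC]

theorem eq_outCut_treeSide {C : Set (HalfEdge E)} (hC : G.IsDirectedCocycle C)
    (hs : arcEdges C ⊆ Tᶜ ∪ {a.1}) (haC : a ∈ C) : C = G.outCut (G.treeSide T a) := by
  obtain ⟨-, S, rfl, -⟩ := hC
  rw [hT.eq_treeSide hs haC]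

end IsSpanningTree

section Signature

variable {σ : Set (Set (HalfEdge E))} {T : Set E}

theorem mem_signatureAtlas_iff (hσ : G.IsCocycleSignature σ) (hT : G.IsSpanningTree T)
    {a : HalfEdge E} (ha : a.1 ∈ T) :
    a ∈ signatureAtlas σ T ↔ G.outCut (G.treeSide T a) ∈ σ := by
  constructor
  · rintro (h | ⟨C, hC, hs, haC⟩)
    · exact absurd ha h
    · rwa [← hT.eq_outCut_treeSide (hσ.1 C hC) hs haC]
  · exact fun h => Or.inr ⟨_, h, arcEdges_outCut_treeSide, hT.mem_outCut_treeSide ha⟩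

theorem rev_mem_signatureAtlas_iff [Finite E] (hσ : G.IsCocycleSignature σ) (hT : G.IsSpanningTree T)
    {a : HalfEdge E} (ha : a.1 ∈ T) :
    a.rev ∈ signatureAtlas σ T ↔ a ∉ signatureAtlas σ T := by
  rw [mem_signatureAtlas_iff hσ hT ha, mem_signatureAtlas_iff (a := a.rev) hσ hT ha]
  obtain ⟨C, hC, haC, rfl⟩ := hT.exists_fundamental_cocycle ha
  have hrev : revArcs (G.outCut (G.treeSide T a)) = G.outCut (G.treeSide T a.rev) := by
    refine hT.eq_outCut_treeSide hC.revArcs ?_ (by simpa using haC)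
    rw [arcEdges_revArcs]
    exact arcEdges_outCut_treeSide
  rw [← hrev]
  rcases hσ.2 _ hC with ⟨h1, h2⟩ | ⟨h1, h2⟩
  · exact iff_of_false h2 (not_not.2 h1)
  · exact iff_of_true h1 h2

/-- Otherwise the vertices reached have a nonempty outgoing cut, all of whose arcs are in the first
atlas and reversed in the second. A directed cocycle in this cut would be in `σ` because of `T₁`,
and its reverse because of `T₂`. -/
theorem dreach_of_isTriangulating [Finite E] (hσ : G.IsCocycleSignature σ) (hσ' : G.IsTriangulating σ)
    {T₁ T₂ : Set E} (h₁ : G.IsSpanningTree T₁) (h₂ : G.IsSpanningTree T₂) (a : HalfEdge E) :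
    G.DReach {b | ¬ (b ∈ signatureAtlas σ T₁ ∧ b.rev ∈ signatureAtlas σ T₂)}
      (G.head a) (G.tail a) := by
  by_contra hcon
  set F : Set (HalfEdge E) := {b | ¬ (b ∈ signatureAtlas σ T₁ ∧ b.rev ∈ signatureAtlas σ T₂)}
  let S : Set V := {v | G.DReach F (G.head a) v}
  have hS : G.outCut S ⊆ {b | b ∈ signatureAtlas σ T₁ ∧ b.rev ∈ signatureAtlas σ T₂} := by
    intro b hb
    by_contra hbF
    exact hb.2 (DReach.tail_step hb.1 hbF)
  have haS : a.rev ∈ G.outCut S := by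
    refine ⟨?_, ?_⟩
    · rw [tail_rev]
      exact Relation.ReflTransGen.refl
    · rw [head_rev]
      exact hcon
  obtain ⟨C, hC, -, hCS⟩ := exists_isDirectedCocycle haS
  have e1 : C ∈ σ := hσ' T₁ h₁ C hC fun b hb => (hS (hCS hb)).1
  have e2 : revArcs C ∈ σ := hσ' T₂ h₂ _ hC.revArcs fun b hb => by
    have := (hS (hCS hb)).2
    rwa [rev_rev] at this
  rcases hσ.2 C hC with ⟨-, h⟩ | ⟨-, h⟩
  · exact h e2
  · exact h e1

end Signature

/-! ### The root atlas as a signature atlas. -/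

section Root

/-- The cocycle signature that directs every cocycle away from `q`. -/
def rootSignature (G : Multigraph V E) (q : V) : Set (Set (HalfEdge E)) :=
  {C | G.IsDirectedCocycle C ∧ ∃ S, q ∈ S ∧ C = G.outCut S}

theorem isCocycleSignature_rootSignature (hG : G.Connected) (q : V) :
    G.IsCocycleSignature (G.rootSignature q) := by
  refine ⟨fun C hC => hC.1, fun C hC => ?_⟩
  obtain ⟨hne, S, hS, hmin⟩ := id hC
  have hiff : ∀ S', C = G.outCut S' → (C ∈ G.rootSignature q ↔ q ∈ S') := by
    intro S' hS'
    constructor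
    · rintro ⟨-, S'', hq, h''⟩
      rwa [← hG.eq_of_outCut_eq (h'' ▸ hne) (h''.symm.trans hS')]
    · exact fun hq => ⟨hC, S', hq, hS'⟩
  have hrev : revArcs C ∈ G.rootSignature q ↔ q ∉ S := by
    constructor
    · rintro ⟨-, S'', hq, h''⟩
      have : C = G.outCut S''ᶜ := by rw [← revArcs_outCut, ← h'', revArcs_revArcs]
      rw [hG.eq_of_outCut_eq (hS ▸ hne) (hS.symm.trans this)]
      exact fun h => h hq
    · exact fun hq => ⟨hC.revArcs, Sᶜ, hq, by rw [← revArcs_outCut, hS]⟩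
  rw [hiff S hS, hrev]
  by_cases hq : q ∈ S
  · exact Or.inl ⟨hq, not_not.2 hq⟩
  · exact Or.inr ⟨hq, hq⟩

theorem rootAtlas_eq_signatureAtlas [Finite E] (hG : G.Connected) (q : V) {T : Set E}
    (hT : G.IsSpanningTree T) :
    G.rootAtlas q T = signatureAtlas (G.rootSignature q) T := by
  ext a
  by_cases ha : a.1 ∈ T
  · rw [mem_signatureAtlas_iff (isCocycleSignature_rootSignature hG q) hT ha]
    have h1 : a ∈ G.rootAtlas q T ↔ q ∈ G.treeSide T a := by
      constructor
      · rintro (h | h)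
        · exact absurd ha h
        · exact h.symm
      · exact fun h => Or.inr (Reach.symm h)
    rw [h1]
    obtain ⟨C, hC, haC, rfl⟩ := hT.exists_fundamental_cocycle ha
    constructor
    · exact fun h => ⟨hC, _, h, rfl⟩
    · rintro ⟨-, S, hq, h⟩
      rwa [hG.eq_of_outCut_eq hC.1 h]
  · exact iff_of_true (Or.inl ha) (Or.inl ha)

/-- If `q` were on the far side `Sᶜ`, a tree walk from `q` would enter `S` for the first time along
some `b`. The atlas directs the edge of `b` away from `q`, that is, into `S`, whereas the cocycle
directs it out of `S`. -/
theorem isTriangulating_rootSignature [Finite E] (hG : G.Connected) (q : V) :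
    G.IsTriangulating (G.rootSignature q) := by
  intro T hT C hC hsub
  rw [← rootAtlas_eq_signatureAtlas hG q hT] at hsub
  obtain ⟨⟨a, ha⟩, S, rfl, -⟩ := id hC
  refine ⟨hC, S, ?_, rfl⟩
  by_contra hq
  -- Either the walk has not entered `S` yet, or `b` is its first entering arc; up to that point it
  -- uses no edge of the cut.
  have key : ∀ v, G.Reach T q v →
      (v ∉ S ∧ G.Reach {e | e ∈ T ∧ e ∉ arcEdges (G.outCut S)} q v) ∨
      ∃ b : HalfEdge E, b.1 ∈ T ∧ G.tail b ∉ S ∧ G.head b ∈ S ∧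
        G.Reach {e | e ∈ T ∧ e ∉ arcEdges (G.outCut S)} q (G.tail b) := by
    intro v hv
    induction hv with
    | refl => exact Or.inl ⟨hq, Relation.ReflTransGen.refl⟩
    | tail _ hbc ih =>
      obtain ⟨b, hb, rfl, rfl⟩ := hbc
      rcases ih with ⟨h1, h2⟩ | h
      · by_cases hh : G.head b ∈ S
        · exact Or.inr ⟨b, hb, h1, hh, h2⟩
        · refine Or.inl ⟨hh, h2.tail_step ⟨hb, ?_⟩⟩
          rw [mem_arcEdges_outCut]
          tauto
      · exact Or.inr h
  rcases key _ (hT.2 q (G.tail a)) with h | ⟨b, hb, hbt, hbh, hr⟩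
  · exact h.1 ha.1
  · have hbS : b.rev ∈ G.outCut S := by
      refine ⟨by rwa [tail_rev], by rwa [head_rev]⟩
    have hr' : G.Reach (T \ {b.1}) q (G.tail b) := by
      refine hr.mono ?_
      rintro e ⟨he, he'⟩
      refine ⟨he, ?_⟩
      rintro rfl
      exact he' ⟨b.rev, hbS, rfl⟩
    rcases hsub hbS with h | h
    · exact h hb
    · refine hT.head_not_mem_treeSide hb ?_
      rw [tail_rev] at h
      exact hr'.symm.trans h

end Root

end Multigraph

/-! ### The Bernardi tour and its dissecting property. -/

namespace Multigraph

variable {V E : Type*} {G : Multigraph V E}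

theorem exists_step_of_iterate {α : Type*} (f : α → α) (P : α → Prop) (x : α) {m n : ℕ}
    (hmn : m ≤ n) (hm : ¬ P (f^[m] x)) (hn : P (f^[n] x)) :
    ∃ j, m ≤ j ∧ j < n ∧ ¬ P (f^[j] x) ∧ P (f (f^[j] x)) := by
  induction n, hmn using Nat.le_induction with
  | base => exact absurd hn hm
  | succ n hmn ih =>
    by_cases h : P (f^[n] x)
    · obtain ⟨j, h1, h2, h3⟩ := ih h
      exact ⟨j, h1, by omega, h3⟩
    · exact ⟨n, hmn, by omega, h, by rwa [← Function.iterate_succ_apply' f]⟩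

namespace RibbonStructure

variable (R : G.RibbonStructure)

theorem vert_next (h : HalfEdge E) : G.vert (R.next h) = G.vert h :=
  (R.sameCycle_iff _ _).1 (Equiv.Perm.sameCycle_apply_left.2 (Equiv.Perm.SameCycle.refl _ _))

/-- By finiteness, forward powers of `next` already run through all half-edges at a vertex. -/
theorem mem_of_next_mem [Finite E] {X : Set (HalfEdge E)} (hX : ∀ h ∈ X, R.next h ∈ X)
    {h k : HalfEdge E} (hh : h ∈ X) (hk : G.vert h = G.vert k) : k ∈ X := by
  obtain ⟨i, rfl⟩ := ((R.sameCycle_iff h k).2 hk).exists_nat_pow_eq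
  clear hk
  induction i with
  | zero => exact hh
  | succ i ih =>
    rw [pow_succ', Equiv.Perm.mul_apply]
    exact hX _ ih

variable {T : Set E}

theorem tourStep_of_mem {h : HalfEdge E} (hh : h.1 ∈ T) : R.tourStep T h = R.next h.rev :=
  if_pos hh

theorem tourStep_of_not_mem {h : HalfEdge E} (hh : h.1 ∉ T) : R.tourStep T h = R.next h :=
  if_neg hh

theorem tourStep_injective : Function.Injective (R.tourStep T) := by
  intro h k hhk
  unfold tourStep at hhk
  split_ifs at hhk with h1 h2 h2
  · exact rev_injective (R.next.injective hhk)
  · have := R.next.injective hhk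
    exact absurd (this ▸ h1 : k.1 ∈ T) h2
  · have := R.next.injective hhk
    exact absurd (this ▸ h2 : h.1 ∈ T) h1
  · exact R.next.injective hhk

/-- The tour leaves a side of a tree edge only along that edge. -/
theorem eq_of_tourStep_leaves (hT : G.IsSpanningTree T) {a x : HalfEdge E} (ha : a.1 ∈ T)
    (h1 : G.vert x ∈ G.treeSide T a) (h2 : G.vert (R.tourStep T x) ∉ G.treeSide T a) :
    x = a := by
  by_cases hx : x.1 ∈ T
  · rw [R.tourStep_of_mem hx, R.vert_next] at h2
    by_cases hxa : x.1 = a.1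
    · rcases eq_or_eq_rev hxa with rfl | rfl
      · rfl
      · exact absurd h1 (hT.head_not_mem_treeSide ha)
    · exact absurd ((treeSide_crossing hx hxa).1 h1) h2
  · rw [R.tourStep_of_not_mem hx, R.vert_next] at h2
    exact absurd h1 h2

theorem eq_of_tourStep_enters {a x : HalfEdge E} (h1 : G.vert x ∉ G.treeSide T a) (h2 : G.vert (R.tourStep T x) ∈ G.treeSide T a) :
    x = a.rev := by
  by_cases hx : x.1 ∈ T
  · rw [R.tourStep_of_mem hx, R.vert_next] at h2
    by_cases hxa : x.1 = a.1
    · rcases eq_or_eq_rev hxa with rfl | rfl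
      · exact absurd (tail_mem_treeSide T x) h1
      · rfl
    · exact absurd ((treeSide_crossing hx hxa).2 h2) h1
  · rw [R.tourStep_of_not_mem hx, R.vert_next] at h2
    exact absurd h2 h1

/-- The Bernardi tour around a spanning tree visits every half-edge. -/
theorem exists_iterate_tourStep_eq [Finite E] (hT : G.IsSpanningTree T) (h₀ h : HalfEdge E) :
    ∃ n, (R.tourStep T)^[n] h₀ = h := by
  set f := R.tourStep T with hf
  let X : Set (HalfEdge E) := {h | ∃ n, f^[n] h₀ = h}
  have hfX : ∀ x ∈ X, f x ∈ X := by
    rintro _ ⟨n, rfl⟩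
    exact ⟨n + 1, Function.iterate_succ_apply' f n h₀⟩
  have hiter : ∀ x ∈ X, ∀ n, f^[n] x ∈ X := by
    rintro _ ⟨m, rfl⟩ n
    exact ⟨n + m, Function.iterate_add_apply f n m h₀⟩
  -- The tour is periodic. After walking along a tree edge it has to come back to the side it left,
  -- and it can do so only through the opposite half-edge.
  have hrev : ∀ x ∈ X, x.1 ∈ T → x.rev ∈ X := by
    intro x hx hxT
    obtain ⟨m, hm, hper⟩ := (R.tourStep_injective (T := T)).mem_periodicPts x
    rw [Function.IsPeriodicPt, Function.IsFixedPt] at hper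
    have h1 : ¬ G.vert (f^[1] x) ∈ G.treeSide T x := by
      rw [Function.iterate_one, hf, R.tourStep_of_mem hxT, R.vert_next]
      exact hT.head_not_mem_treeSide hxT
    obtain ⟨j, -, -, h2, h3⟩ := exists_step_of_iterate f (fun y => G.vert y ∈ G.treeSide T x) x
      (m := 1) (n := m) hm h1 (by rw [hf, hper]; exact tail_mem_treeSide T x)
    rw [← R.eq_of_tourStep_enters h2 h3]
    exact hiter x hx j
  have hnext : ∀ x ∈ X, R.next x ∈ X := by
    intro x hx
    by_cases hxT : x.1 ∈ T
    · have := hfX _ (hrev x hx hxT)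
      rwa [hf, R.tourStep_of_mem (h := x.rev) hxT, rev_rev] at this
    · have := hfX _ hx
      rwa [hf, R.tourStep_of_not_mem hxT] at this
  -- Being closed under `next` and under reversal of tree edges, the visited set spreads along the
  -- tree.
  have hvert : ∀ v, G.Reach T (G.vert h₀) v → ∀ k : HalfEdge E, G.vert k = v → k ∈ X := by
    intro v hv
    induction hv with
    | refl => exact fun k hk => R.mem_of_next_mem hnext ⟨0, rfl⟩ hk.symm
    | tail _ hbc ih =>
      obtain ⟨a, ha, hb, hc⟩ := hbc
      intro k hk
      exact R.mem_of_next_mem hnext (hrev a (ih a hb) ha) (hc.trans hk.symm)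
  exact hvert _ (hT.2 _ _) h rfl

theorem reachesFirst_rev_iff [Finite E] (hT : G.IsSpanningTree T) (h₀ h : HalfEdge E) :
    R.ReachesFirst h₀ T h.rev ↔ ¬ R.ReachesFirst h₀ T h := by
  classical
  constructor
  · rintro ⟨n, hn, hn'⟩ ⟨m, hm, hm'⟩
    rw [rev_rev] at hn'
    rcases lt_trichotomy m n with h' | rfl | h'
    · exact hn' m h' hm
    · exact rev_ne h (hn.symm.trans hm)
    · exact hm' n h' hn
  · intro hcon
    have hex := R.exists_iterate_tourStep_eq hT h₀ h.rev
    refine ⟨Nat.find hex, Nat.find_spec hex, ?_⟩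
    intro m hm hm'
    rw [rev_rev] at hm'
    refine hcon ⟨m, hm', fun k hk => Nat.find_min hex (hk.trans hm)⟩

theorem rev_mem_bernardiAtlas_iff [Finite E] (hT : G.IsSpanningTree T) (h₀ : HalfEdge E)
    {a : HalfEdge E} (ha : a.1 ∉ T) :
    a.rev ∈ R.bernardiAtlas h₀ T ↔ a ∉ R.bernardiAtlas h₀ T := by
  have := R.reachesFirst_rev_iff hT h₀ a
  simp only [bernardiAtlas, Set.mem_ofPred_eq, rev_rev, rev_fst, ha, false_or]
  tauto

/-- An arc `b` of the first atlas entering the tail side of `a` on another edge is cut first at its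
head, inside that side. The tour around `T₁` must do this before step `n`, while the two tours still
agree; so the second tour cuts `b` first at the same end, and the second atlas does not contain
`b.rev`. -/
theorem no_entering_arc_of_first_difference [Finite E] {T₁ T₂ : Set E} (h₁ : G.IsSpanningTree T₁)
    {h₀ a : HalfEdge E} {n : ℕ}
    (ha₁ : (R.tourStep T₁)^[n] h₀ = a)
    (heq : ∀ m ≤ n, (R.tourStep T₂)^[m] h₀ = (R.tourStep T₁)^[m] h₀)
    (hagree : ∀ m < n, (((R.tourStep T₁)^[m] h₀).1 ∈ T₁ ↔ ((R.tourStep T₁)^[m] h₀).1 ∈ T₂))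
    (hm₁ : a.1 ∈ T₁) (hm₂ : a.1 ∉ T₂) {b : HalfEdge E}
    (hb₁ : b ∈ R.bernardiAtlas h₀ T₁) (hb₂ : b.rev ∈ R.bernardiAtlas h₀ T₂)
    (ht : G.tail b ∉ G.treeSide T₁ a) : G.head b ∉ G.treeSide T₁ a := by
  classical
  intro hh
  have hne : ∀ m < n, ((R.tourStep T₁)^[m] h₀).1 ≠ a.1 := by
    intro m hm h
    have := hagree m hm
    rw [h] at this
    exact hm₂ (this.1 hm₁)
  by_cases hba : b.1 = a.1
  · rcases eq_or_eq_rev hba with rfl | rfl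
    · exact ht (tail_mem_treeSide _ _)
    -- Here `b = a.rev`. The second tour meets the edge of `a` for the first time at `a`, so its
    -- atlas contains `a.rev` and not `a`.
    · rcases hb₂ with h | ⟨k, hk, hk'⟩
      · exact hm₂ h
      · rw [rev_rev] at hk hk'
        rcases lt_trichotomy k n with hkn | rfl | hkn
        · rw [heq k hkn.le] at hk
          exact hne k hkn (by rw [hk]; rfl)
        · rw [heq k le_rfl, ha₁] at hk
          exact rev_ne a hk.symm
        · exact hk' n hkn (by rw [heq n le_rfl, ha₁, rev_rev])
  · have hbT : b.1 ∉ T₁ := fun h => ht ((treeSide_crossing h hba).2 hh)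
    obtain ⟨k, hk, hk'⟩ := hb₁.resolve_left hbT
    rw [rev_rev] at hk'
    have hkn : k < n := by
      rcases lt_trichotomy k n with h | rfl | h
      · exact h
      · rw [ha₁] at hk
        exact absurd (by rw [hk]; rfl) hba
      · exfalso
        have hex := R.exists_iterate_tourStep_eq h₁ h₀ b
        have hspec := Nat.find_spec hex
        have hmin : ∀ m, m < Nat.find hex → (R.tourStep T₁)^[m] h₀ ≠ b :=
          fun m => Nat.find_min hex
        generalize Nat.find hex = l at hspec hmin
        have hkl : k < l := by
          by_contra hcon
          rcases lt_or_eq_of_le (not_lt.1 hcon) with h' | rfl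
          · exact hk' l h' hspec
          · exact rev_ne b (hk.symm.trans hspec)
        -- Between `b.rev` at time `k` and the first visit of `b` at time `l` the tour leaves the
        -- side, hence passes `a` at some time `j`. As it was already at `a` at time `n < j`, it
        -- would have met `b` at the earlier time `l - j + n`.
        obtain ⟨j, hj1, hj2, hj3, hj4⟩ := exists_step_of_iterate (R.tourStep T₁)
          (fun y => G.vert y ∉ G.treeSide T₁ a) h₀ hkl.le (by rw [hk]; exact not_not.2 hh)
          (by rw [hspec]; exact ht)
        have hja := R.eq_of_tourStep_leaves h₁ hm₁ (not_not.1 hj3) hj4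
        refine hmin (l - j + n) (by omega) ?_
        rw [Function.iterate_add_apply, ha₁, ← hja, ← Function.iterate_add_apply,
          Nat.sub_add_cancel hj2.le, hspec]
    have hbT₂ : b.1 ∉ T₂ := by
      have := hagree k hkn
      rw [hk] at this
      exact fun h => hbT (this.2 h)
    obtain ⟨k₂, hk₂, hk₂'⟩ := hb₂.resolve_left hbT₂
    rw [rev_rev] at hk₂ hk₂'
    rcases lt_trichotomy k₂ k with h | rfl | h
    · rw [heq k₂ (by omega)] at hk₂
      exact hk' k₂ h hk₂
    · rw [heq k₂ (by omega), hk] at hk₂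
      exact rev_ne b hk₂
    · exact hk₂' k h (by rw [heq k (by omega), hk])

/-- The Bernardi atlas is dissecting. -/
theorem exists_cut_of_ne [Finite E] {T₁ T₂ : Set E} (h₁ : G.IsSpanningTree T₁)
    (h₂ : G.IsSpanningTree T₂) (hne : T₁ ≠ T₂) (h₀ : HalfEdge E) :
    ∃ W : Set V, W.Nonempty ∧ Wᶜ.Nonempty ∧
      ∀ b ∈ R.bernardiAtlas h₀ T₁, b.rev ∈ R.bernardiAtlas h₀ T₂ → G.tail b ∉ W →
        G.head b ∉ W := by
  classical
  have hex : ∃ n, ¬ (((R.tourStep T₁)^[n] h₀).1 ∈ T₁ ↔ ((R.tourStep T₁)^[n] h₀).1 ∈ T₂) := by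
    by_contra hcon
    push Not at hcon
    refine hne (Set.ext fun e => ?_)
    obtain ⟨n, hn⟩ := R.exists_iterate_tourStep_eq h₁ h₀ (e, true)
    have := hcon n
    rwa [hn] at this
  have hspec := Nat.find_spec hex
  have hmin : ∀ m < Nat.find hex,
      (((R.tourStep T₁)^[m] h₀).1 ∈ T₁ ↔ ((R.tourStep T₁)^[m] h₀).1 ∈ T₂) :=
    fun m hm => not_not.1 (Nat.find_min hex hm)
  generalize Nat.find hex = n at hspec hmin
  have heq : ∀ m ≤ n, (R.tourStep T₂)^[m] h₀ = (R.tourStep T₁)^[m] h₀ := by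
    intro m hm
    induction m with
    | zero => rfl
    | succ m ih =>
      rw [Function.iterate_succ_apply', Function.iterate_succ_apply', ih (by omega)]
      have := hmin m (by omega)
      generalize (R.tourStep T₁)^[m] h₀ = x at this
      by_cases hx : x.1 ∈ T₁
      · rw [R.tourStep_of_mem hx, R.tourStep_of_mem (this.1 hx)]
      · rw [R.tourStep_of_not_mem hx, R.tourStep_of_not_mem fun h => hx (this.2 h)]
  generalize ha : (R.tourStep T₁)^[n] h₀ = a at hspec
  by_cases hm : a.1 ∈ T₁
  · have hm₂ : a.1 ∉ T₂ := fun h => hspec (iff_of_true hm h)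
    exact ⟨G.treeSide T₁ a, ⟨_, tail_mem_treeSide _ _⟩, ⟨_, h₁.head_not_mem_treeSide hm⟩,
      fun b hb hb' ht => R.no_entering_arc_of_first_difference h₁ ha heq hmin hm hm₂ hb hb' ht⟩
  · have hm₂ : a.1 ∈ T₂ := by
      by_contra h
      exact hspec (iff_of_false hm h)
    -- With the roles of the trees exchanged, arcs are reversed too, so the complementary side is
    -- used.
    refine ⟨(G.treeSide T₂ a)ᶜ, ⟨_, h₂.head_not_mem_treeSide hm₂⟩,
      ⟨_, not_not.2 (tail_mem_treeSide _ _)⟩, fun b hb hb' ht hh => ?_⟩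
    refine R.no_entering_arc_of_first_difference (b := b.rev) h₂ ((heq n le_rfl).trans ha)
      (fun m hm => (heq m hm).symm) (fun m hm => ?_) hm₂ hm hb' (by rwa [rev_rev]) hh
      (by rw [head_rev]; exact not_not.1 ht)
    rw [heq m hm.le]
    exact (hmin m hm).symm

end RibbonStructure

end Multigraph

/-! ### Atlas pairs and injectivity on reversal classes. -/

namespace Multigraph

variable {V E : Type*} {G : Multigraph V E}

/-- A pair of a dissecting external atlas `A` and a triangulating internal atlas `A'`. -/
structure IsAtlasPair (G : Multigraph V E) (A A' : Set E → Set (HalfEdge E)) : Prop where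
  ext_mem : ∀ T, G.IsSpanningTree T → ∀ a : HalfEdge E, a.1 ∈ T → a ∈ A T
  ext_rev : ∀ T, G.IsSpanningTree T → ∀ a : HalfEdge E, a.1 ∉ T → (a.rev ∈ A T ↔ a ∉ A T)
  int_mem : ∀ T, G.IsSpanningTree T → ∀ a : HalfEdge E, a.1 ∉ T → a ∈ A' T
  int_rev : ∀ T, G.IsSpanningTree T → ∀ a : HalfEdge E, a.1 ∈ T → (a.rev ∈ A' T ↔ a ∉ A' T)
  dissecting : ∀ T₁ T₂, G.IsSpanningTree T₁ → G.IsSpanningTree T₂ → T₁ ≠ T₂ →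
    ∃ W : Set V, W.Nonempty ∧ Wᶜ.Nonempty ∧
      ∀ b ∈ A T₁, b.rev ∈ A T₂ → G.tail b ∉ W → G.head b ∉ W
  triangulating : ∀ T₁ T₂, G.IsSpanningTree T₁ → G.IsSpanningTree T₂ → ∀ a : HalfEdge E,
    G.DReach {b | ¬ (b ∈ A' T₁ ∧ b.rev ∈ A' T₂)} (G.head a) (G.tail a)

theorem isAtlasPair_signatureAtlas [Finite E] (R : G.RibbonStructure) (h₀ : HalfEdge E)
    {σ : Set (Set (HalfEdge E))} (hσ : G.IsCocycleSignature σ) (hσ' : G.IsTriangulating σ) :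
    G.IsAtlasPair (R.bernardiAtlas h₀) (signatureAtlas σ) where
  ext_mem _ _ _ ha := Or.inl ha
  ext_rev _ hT _ ha := R.rev_mem_bernardiAtlas_iff hT h₀ ha
  int_mem _ _ _ ha := Or.inl ha
  int_rev _ hT _ ha := rev_mem_signatureAtlas_iff hσ hT ha
  dissecting _ _ h₁ h₂ hne := R.exists_cut_of_ne h₁ h₂ hne h₀
  triangulating _ _ h₁ h₂ a := dreach_of_isTriangulating hσ hσ' h₁ h₂ a

/-- The net flow through a cut is zero, so a flow that never enters `W` does not leave it either. -/
theorem IsFlow.eq_zero_of_one_way [Fintype E] {c : HalfEdge E → ℤ} (hc : G.IsFlow c) {W : Set V}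
    (hW : ∀ a, G.tail a ∉ W → G.head a ∈ W → c a ≤ 0) {a : HalfEdge E} (ha : a ∈ G.outCut W) :
    c a = 0 := by
  have hsum := hc.sum_mul_eq_zero (isTension_outCut W)
  have hnn : ∀ b ∈ (Finset.univ : Finset (HalfEdge E)), 0 ≤ c b * arcChain (G.outCut W) b := by
    intro b _
    have h1 := hW b
    have h2 := hW b.rev
    rw [hc.1, tail_rev, head_rev] at h2
    have h3 : b ∈ G.outCut W ↔ G.tail b ∈ W ∧ G.head b ∉ W := Iff.rfl
    have h4 : b.rev ∈ G.outCut W ↔ G.head b ∈ W ∧ G.tail b ∉ W := by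
      rw [mem_outCut, tail_rev, head_rev]
    clear hW hsum
    by_cases e1 : G.tail b ∈ W <;> by_cases e2 : G.head b ∈ W <;>
      simp_all [arcChain, arcInd]
  have := (Finset.sum_eq_zero_iff_of_nonneg hnn).1 hsum a (Finset.mem_univ a)
  rwa [(arcChain_eq_one fun b hb hb' => by
    rw [mem_outCut, tail_rev] at hb'; exact hb.2 hb'.1).2 ha, mul_one] at this

namespace IsAtlasPair

variable {A A' : Set E → Set (HalfEdge E)} (h : G.IsAtlasPair A A')

include h

theorem exists_isInducedMap : ∃ f, G.IsInducedMap A A' f := by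
  have key : ∀ T : G.SpanningTree, ∃ O : EdgeOrientation E, O.arcs = A T ∩ A' T := by
    intro T
    refine EdgeOrientation.exists_arcs_eq fun a => ?_
    by_cases ha : a.1 ∈ T.1
    · have h1 := h.ext_mem T T.2 a ha
      have h2 := h.ext_mem T T.2 a.rev ha
      have h3 := h.int_rev T T.2 a ha
      simp only [Set.mem_inter_iff]
      tauto
    · have h1 := h.int_mem T T.2 a ha
      have h2 := h.int_mem T T.2 a.rev ha
      have h3 := h.ext_rev T T.2 a ha
      simp only [Set.mem_inter_iff]
      tauto
  choose f hf using key
  exact ⟨f, hf⟩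

variable {f : G.SpanningTree → EdgeOrientation E} (hf : G.IsInducedMap A A' f)

include hf

theorem mem_arcs_of_mem {T : G.SpanningTree} {a : HalfEdge E} (ha : a.1 ∈ T.1) :
    a ∈ (f T).arcs ↔ a ∈ A' T := by
  rw [hf T]
  exact and_iff_right (h.ext_mem T T.2 a ha)

theorem mem_arcs_of_not_mem {T : G.SpanningTree} {a : HalfEdge E} (ha : a.1 ∉ T.1) :
    a ∈ (f T).arcs ↔ a ∈ A T := by
  rw [hf T]
  exact and_iff_left (h.int_mem T T.2 a ha)

/-- The core contradiction between dissecting and triangulating. It is stated for an arbitrary flow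
and tension, with agreement of the orientations required only on edges of exactly one tree where
both chains vanish, so that it serves both for the classes and for the subgraphs. -/
theorem false_of_flow_of_tension [Fintype E] {T₁ T₂ : G.SpanningTree} (hne : T₁ ≠ T₂)
    {c d : HalfEdge E → ℤ} (hc : G.IsFlow c) (hd : G.IsTension d)
    (hcA : ∀ a, 0 < c a → a ∈ A T₁ ∧ a.rev ∈ A T₂)
    (hdA : ∀ a, 0 < d a → a ∈ A' T₁ ∧ a.rev ∈ A' T₂)
    (heq : ∀ a : HalfEdge E, ¬ (a.1 ∈ T₁.1 ↔ a.1 ∈ T₂.1) → c a = 0 → d a = 0 →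
      (a ∈ (f T₁).arcs ↔ a ∈ (f T₂).arcs)) : False := by
  obtain ⟨W, ⟨u, hu⟩, ⟨v, hv⟩, hW⟩ := h.dissecting T₁ T₂ T₁.2 T₂.2 fun h' => hne (Subtype.ext h')
  have htri := h.triangulating T₁ T₂ T₁.2 T₂.2
  have hd0 : ∀ a, d a = 0 := by
    obtain ⟨y, rfl⟩ := hd
    -- The potential does not increase along the arcs of this set. They lead from the head of any
    -- arc to its tail and conversely, so the potential is equal at both ends.
    have hmono : ∀ u v, G.DReach {b | ¬ (b ∈ A' T₁ ∧ b.rev ∈ A' T₂)} u v → y v ≤ y u := by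
      intro u v huv
      induction huv with
      | refl => exact le_rfl
      | tail _ hbc ih =>
        obtain ⟨b, hb, rfl, rfl⟩ := hbc
        have : ¬ 0 < G.coboundary y b := fun h' => hb (hdA b h')
        rw [coboundary] at this
        omega
    intro a
    have h1 := hmono _ _ (htri a)
    have h2 := hmono _ _ (htri a.rev)
    rw [head_rev, tail_rev] at h2
    rw [coboundary]
    omega
  have hc0 : ∀ a ∈ G.outCut W, c a = 0 := fun a ha => hc.eq_zero_of_one_way (fun b hb hb' => by
    by_contra hcon
    obtain ⟨h1, h2⟩ := hcA b (by omega)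
    exact hW b h1 h2 hb hb') ha
  -- On an arc entering `W` both chains vanish. If its edge is in exactly one tree, the agreement of
  -- the orientations turns exclusion by the internal atlases into inclusion in the external ones;
  -- the edges in both trees or in neither are immediate.
  have hno : ∀ b : HalfEdge E, ¬ (b ∈ A' T₁ ∧ b.rev ∈ A' T₂) → G.tail b ∉ W → G.head b ∉ W := by
    intro b hbF hbt hbh
    have hcb : c b = 0 := by
      have := hc0 b.rev ⟨by rwa [tail_rev], by rwa [head_rev]⟩
      rw [hc.1] at this
      omega
    have hWb := fun h1 h2 => hW b h1 h2 hbt hbh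
    by_cases h1 : b.1 ∈ T₁.1
    · by_cases h2 : b.1 ∈ T₂.1
      · exact hWb (h.ext_mem _ T₁.2 _ h1) (h.ext_mem _ T₂.2 _ h2)
      · have e := heq b (fun h' => h2 (h'.1 h1)) hcb (hd0 b)
        have e2 := h.int_mem _ T₂.2 b.rev h2
        have e3 : b ∉ (f T₂).arcs := by
          rw [← e, h.mem_arcs_of_mem hf h1]
          exact fun h' => hbF ⟨h', e2⟩
        rw [h.mem_arcs_of_not_mem hf h2, ← h.ext_rev _ T₂.2 _ h2] at e3
        exact hWb (h.ext_mem _ T₁.2 _ h1) e3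
    · by_cases h2 : b.1 ∈ T₂.1
      · have e := heq b (fun h' => h1 (h'.2 h2)) hcb (hd0 b)
        have e2 := h.int_mem _ T₁.2 b h1
        have e3 : b ∈ (f T₁).arcs := by
          rw [e, h.mem_arcs_of_mem hf h2]
          by_contra h'
          exact hbF ⟨e2, (h.int_rev _ T₂.2 _ h2).2 h'⟩
        exact hWb ((h.mem_arcs_of_not_mem hf h1).1 e3) (h.ext_mem _ T₂.2 _ h2)
      · exact hbF ⟨h.int_mem _ T₁.2 _ h1, h.int_mem _ T₂.2 b.rev h2⟩
  -- Some arc leaves `W`, and the way back from its head to its tail enters `W`, contrary to `hno`.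
  obtain ⟨a, ha, hat, hah⟩ := (T₁.2.2 u v).exists_exit hu hv
  obtain ⟨b, hb, hbt, hbh⟩ := (htri a).exists_exit (S := Wᶜ) hah (not_not.2 hat)
  exact hno b hb hbt (not_not.1 hbh)

theorem injective_quotient [Fintype E] :
    Function.Injective fun T => Quotient.mk G.cycleCocycleSetoid (f T) := by
  intro T₁ T₂ hT
  by_contra hne
  obtain ⟨X, Y, hs⟩ := cycleCocycleSetoid_iff.1 (Quotient.exact hT)
  have hX : ∀ a, 0 < arcChain X a → a ∈ X := by
    intro a ha
    by_contra h'
    rw [arcChain, arcInd_of_not_mem h'] at ha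
    unfold arcInd at ha
    split_ifs at ha <;> omega
  have hY : ∀ a, 0 < arcChain Y a → a ∈ Y := by
    intro a ha
    by_contra h'
    rw [arcChain, arcInd_of_not_mem h'] at ha
    unfold arcInd at ha
    split_ifs at ha <;> omega
  have hmem : ∀ a ∈ X ∪ Y, (a ∈ A T₁ ∧ a ∈ A' T₁) ∧ a.rev ∈ A T₂ ∧ a.rev ∈ A' T₂ := by
    intro a ha
    rw [hs.reversal.diff_eq] at ha
    refine ⟨?_, ?_⟩
    · have := ha.1
      rwa [hf T₁] at this
    · have := ((f T₂).rev_mem_arcs a).2 ha.2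
      rwa [hf T₂] at this
  refine h.false_of_flow_of_tension hf hne hs.isFlow hs.isTension ?_ ?_ ?_
  · exact fun a ha => ⟨(hmem a (Or.inl (hX a ha))).1.1, (hmem a (Or.inl (hX a ha))).2.1⟩
  · exact fun a ha => ⟨(hmem a (Or.inr (hY a ha))).1.2, (hmem a (Or.inr (hY a ha))).2.2⟩
  · intro a _ h1 h2
    refine EdgeOrientation.diffChain_eq_zero.1 ?_
    rw [hs.diffChain_eq, Pi.add_apply, h1, h2, add_zero]

end IsAtlasPair

end Multigraph

/-! ### From reversal classes to the subgraph–orientation bijection. -/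

theorem mem_iff_of_subset_arcs {E : Type*} {O : EdgeOrientation E} {X : Set (HalfEdge E)}
    (h : X ⊆ O.arcs) (a : HalfEdge E) : a ∈ X ↔ a ∈ O.arcs ∧ a.1 ∈ arcEdges X := by
  rw [mem_arcEdges]
  constructor
  · exact fun ha => ⟨h ha, Or.inl ha⟩
  · rintro ⟨h1, h2 | h2⟩
    · exact h2
    · exact absurd h1 ((O.rev_mem_arcs a).1 (h h2))

theorem arcChain_congr_of_subset_arcs {E : Type*} {O : EdgeOrientation E}
    {X X' : Set (HalfEdge E)} (h : X ⊆ O.arcs) (h' : X' ⊆ O.arcs) {a : HalfEdge E}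
    (ha : a.1 ∈ arcEdges X ↔ a.1 ∈ arcEdges X') : arcChain X a = arcChain X' a := by
  have h1 : a ∈ X ↔ a ∈ X' := by
    rw [mem_iff_of_subset_arcs h, mem_iff_of_subset_arcs h', ha]
  have h2 : a.rev ∈ X ↔ a.rev ∈ X' := by
    rw [mem_iff_of_subset_arcs h, mem_iff_of_subset_arcs h', rev_fst, ha]
  have h3 : ∀ b : HalfEdge E, (b ∈ X ↔ b ∈ X') → arcInd X b = arcInd X' b := by
    intro b hb
    by_cases hbX : b ∈ X
    · rw [arcInd_of_mem hbX, arcInd_of_mem (hb.1 hbX)]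
    · rw [arcInd_of_not_mem hbX, arcInd_of_not_mem fun h' => hbX (hb.2 h')]
  rw [arcChain, arcChain, h3 a h1, h3 _ h2]

theorem mem_of_arcChain_sub_pos {E : Type*} {X X' : Set (HalfEdge E)} {a : HalfEdge E}
    (ha : 0 < (arcChain X - arcChain X') a) : (a ∈ X ∧ a ∉ X') ∨ (a.rev ∈ X' ∧ a.rev ∉ X) := by
  by_contra hcon
  simp only [Pi.sub_apply, arcChain, arcInd] at ha
  split_ifs at ha <;> first | omega | tauto

theorem mem_arcs_iff_of_arcChain_eq {E : Type*} {O O' : EdgeOrientation E}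
    {X X' : Set (HalfEdge E)} (hX : X ⊆ O.arcs) (hX' : X' ⊆ O'.arcs) {a : HalfEdge E}
    (h : arcChain X a = arcChain X' a) (hor : a.1 ∈ arcEdges X ∨ a.1 ∈ arcEdges X') :
    a ∈ O.arcs ↔ a ∈ O'.arcs := by
  have k₁ := mem_iff_of_subset_arcs hX a
  have k₂ := mem_iff_of_subset_arcs hX a.rev
  have k₃ := mem_iff_of_subset_arcs hX' a
  have k₄ := mem_iff_of_subset_arcs hX' a.rev
  rw [rev_fst, EdgeOrientation.rev_mem_arcs] at k₂ k₄
  clear hX hX'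
  simp only [arcChain, arcInd] at h
  split_ifs at h <;> first | omega | tauto

theorem EdgeOrientation.eq_of_diffChain_eq {E : Type*} {P O O' : EdgeOrientation E}
    (h : P.diffChain O = P.diffChain O') : O = O' := by
  refine eq_of_diffChain_eq_zero fun a => ?_
  have := congrFun h a
  unfold diffChain at *
  omega

theorem EdgeOrientation.diffChain_eq_sub {E : Type*} (P O O' : EdgeOrientation E) :
    O.diffChain O' = P.diffChain O' - P.diffChain O := by
  ext a
  simp only [diffChain, Pi.sub_apply]
  ring

namespace Multigraph

variable {V E : Type*} {G : Multigraph V E}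

theorem IsForest.mono {T T' : Set E} (hT : G.IsForest T') (h : T ⊆ T') : G.IsForest T :=
  fun C hC hs => hT C hC (hs.trans h)

theorem IsConnectedSpanning.mono {T T' : Set E} (hT : G.IsConnectedSpanning T) (h : T ⊆ T') :
    G.IsConnectedSpanning T' :=
  fun u v => (hT u v).mono h

/-- In the fundamental cut of a tree edge, the flow could be nonzero on that edge only. -/
theorem IsFlow.eq_zero_of_supported_on_tree [Fintype E] {c : HalfEdge E → ℤ} (hc : G.IsFlow c)
    {T : Set E} (hT : G.IsSpanningTree T) (h : ∀ a : HalfEdge E, a.1 ∉ T → c a = 0) : c = 0 := by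
  have key : ∀ a : HalfEdge E, a.1 ∈ T → 0 ≤ c a → c a = 0 := by
    intro a ha hca
    refine hc.eq_zero_of_one_way (fun b hb hb' => ?_) (hT.mem_outCut_treeSide ha)
    by_cases hbT : b.1 ∈ T
    · have hba : b.1 = a.1 := by
        by_contra hne
        exact hb ((treeSide_crossing hbT hne).2 hb')
      rcases eq_or_eq_rev hba with rfl | rfl
      · exact absurd (tail_mem_treeSide _ _) hb
      · rw [hc.1]
        omega
    · rw [h b hbT]
  ext a
  by_cases ha : a.1 ∈ T
  · rcases le_total 0 (c a) with h' | h'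
    · exact key a ha h'
    · have := key a.rev ha (by rw [hc.1]; omega)
      rw [hc.1] at this
      simpa using this
  · exact h a ha

theorem IsTension.eq_zero_of_supported_off_connected {d : HalfEdge E → ℤ} (hd : G.IsTension d)
    {T : Set E} (hT : G.IsConnectedSpanning T) (h : ∀ a : HalfEdge E, a.1 ∈ T → d a = 0) :
    d = 0 := by
  obtain ⟨y, rfl⟩ := hd
  have key : ∀ u v, y u = y v := by
    intro u v
    have := reach_iff_of_crossing (G := G) (S := {w | y u = y w}) (T := T) (fun b hb => by
      have := h b hb
      rw [coboundary, sub_eq_zero] at this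
      simp only [Set.mem_ofPred_eq, this]) (hT u v)
    exact this.1 rfl
  ext a
  rw [coboundary, key (G.head a) (G.tail a), sub_self]
  rfl

/-- Off the tree, the edges of the subgraph are those of the flow part; on the tree, the missing
edges are those of the tension part. So the two flows agree off the tree and the two tensions agree
on it, which determines them. -/
theorem orientation_eq_of_subgraph_eq [Fintype E]
    {f : G.SpanningTree → EdgeOrientation E} {T : G.SpanningTree}
    {O₁ O₂ : EdgeOrientation E} {X₁ Y₁ X₂ Y₂ : Set (HalfEdge E)}
    (h₁ : G.IsSplitReversal (f T) O₁ X₁ Y₁) (h₂ : G.IsSplitReversal (f T) O₂ X₂ Y₂)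
    (hS : (T.1 ∪ arcEdges X₁) \ arcEdges Y₁ = (T.1 ∪ arcEdges X₂) \ arcEdges Y₂) :
    O₁ = O₂ := by
  have hSa : ∀ e : E, ((e ∈ T.1 ∨ e ∈ arcEdges X₁) ∧ e ∉ arcEdges Y₁ ↔
      (e ∈ T.1 ∨ e ∈ arcEdges X₂) ∧ e ∉ arcEdges Y₂) := fun e => by
    have := Set.ext_iff.1 hS e
    simpa only [Set.mem_sdiff, Set.mem_union] using this
  have hdis₁ : ∀ e, e ∈ arcEdges X₁ → e ∉ arcEdges Y₁ :=
    fun _ he => Set.disjoint_left.1 h₁.disjoint_arcEdges he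
  have hdis₂ : ∀ e, e ∈ arcEdges X₂ → e ∉ arcEdges Y₂ :=
    fun _ he => Set.disjoint_left.1 h₂.disjoint_arcEdges he
  have hc : arcChain X₁ - arcChain X₂ = 0 := by
    refine (h₁.isFlow.sub h₂.isFlow).eq_zero_of_supported_on_tree T.2 fun a ha => ?_
    have hS' := hSa a.1
    have d₁ := hdis₁ a.1
    have d₂ := hdis₂ a.1
    rw [Pi.sub_apply, arcChain_congr_of_subset_arcs h₁.left_subset h₂.left_subset (by tauto),
      sub_self]
  have hd : arcChain Y₁ - arcChain Y₂ = 0 := by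
    refine (h₁.isTension.sub h₂.isTension).eq_zero_of_supported_off_connected T.2.2 fun a ha => ?_
    have hS' := hSa a.1
    have d₁ := hdis₁ a.1
    have d₂ := hdis₂ a.1
    rw [Pi.sub_apply, arcChain_congr_of_subset_arcs h₁.right_subset h₂.right_subset (by tauto),
      sub_self]
  refine EdgeOrientation.eq_of_diffChain_eq (P := f T) ?_
  rw [h₁.diffChain_eq, h₂.diffChain_eq, sub_eq_zero.1 hc, sub_eq_zero.1 hd]

namespace IsAtlasPair

variable {A A' : Set E → Set (HalfEdge E)} (h : G.IsAtlasPair A A')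
  {f : G.SpanningTree → EdgeOrientation E} (hf : G.IsInducedMap A A' f)

include h hf

/-- The differences of the flows and of the tensions satisfy the sign conditions of
`false_of_flow_of_tension`: an arc violating one would lie in the flow (or tension) part of one
side, and the equality of the subgraphs would force it into that of the other side as well. -/
theorem tree_eq_of_subgraph_eq [Fintype E] {T₁ T₂ : G.SpanningTree} {O₁ O₂ : EdgeOrientation E}
    {X₁ Y₁ X₂ Y₂ : Set (HalfEdge E)} (h₁ : G.IsSplitReversal (f T₁) O₁ X₁ Y₁)
    (h₂ : G.IsSplitReversal (f T₂) O₂ X₂ Y₂)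
    (hS : (T₁.1 ∪ arcEdges X₁) \ arcEdges Y₁ = (T₂.1 ∪ arcEdges X₂) \ arcEdges Y₂) :
    T₁ = T₂ := by
  by_contra hne
  have hSa : ∀ e : E, ((e ∈ T₁.1 ∨ e ∈ arcEdges X₁) ∧ e ∉ arcEdges Y₁ ↔
      (e ∈ T₂.1 ∨ e ∈ arcEdges X₂) ∧ e ∉ arcEdges Y₂) := fun e => by
    have := Set.ext_iff.1 hS e
    simpa only [Set.mem_sdiff, Set.mem_union] using this
  have hdis₁ : ∀ e, e ∈ arcEdges X₁ → e ∉ arcEdges Y₁ :=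
    fun _ he => Set.disjoint_left.1 h₁.disjoint_arcEdges he
  have hdis₂ : ∀ e, e ∈ arcEdges X₂ → e ∉ arcEdges Y₂ :=
    fun _ he => Set.disjoint_left.1 h₂.disjoint_arcEdges he
  have hX₁ := fun a => mem_iff_of_subset_arcs h₁.left_subset a
  have hX₂ := fun a => mem_iff_of_subset_arcs h₂.left_subset a
  have hY₁ := fun a => mem_iff_of_subset_arcs h₁.right_subset a
  have hY₂ := fun a => mem_iff_of_subset_arcs h₂.right_subset a
  refine h.false_of_flow_of_tension hf hne (h₁.isFlow.sub h₂.isFlow)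
    (h₁.isTension.sub h₂.isTension) ?_ ?_ ?_
  · intro a ha
    have hS' := hSa a.1
    have d₁ := hdis₁ a.1
    have d₂ := hdis₂ a.1
    constructor
    · by_contra hA
      have hT : a.1 ∉ T₁.1 := fun h' => hA (h.ext_mem _ T₁.2 _ h')
      have hP : a ∉ (f T₁).arcs := fun h' => hA ((h.mem_arcs_of_not_mem hf hT).1 h')
      have hP' := ((f T₁).rev_mem_arcs a).2 hP
      have k₂ := hX₁ a.rev
      have k₃ := hX₂ a.rev
      rw [rev_fst] at k₂ k₃
      rcases mem_of_arcChain_sub_pos ha with h' | h'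
      · exact hP (h₁.left_subset h'.1)
      · have e := (k₃.1 h'.1).2
        exact h'.2 (k₂.2 ⟨hP', (hS'.2 ⟨Or.inr e, d₂ e⟩).1.resolve_left hT⟩)
    · by_contra hA
      have hT : a.1 ∉ T₂.1 := fun h' => hA (h.ext_mem _ T₂.2 _ h')
      have hP' : a.rev ∉ (f T₂).arcs :=
        fun h' => hA ((h.mem_arcs_of_not_mem (a := a.rev) hf hT).1 h')
      have hP := not_not.1 (fun h' => hP' (((f T₂).rev_mem_arcs a).2 h'))
      have k₁ := hX₁ a
      have k₃ := hX₂ a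
      rcases mem_of_arcChain_sub_pos ha with h' | h'
      · have e := (k₁.1 h'.1).2
        exact h'.2 (k₃.2 ⟨hP, (hS'.1 ⟨Or.inr e, d₁ e⟩).1.resolve_left hT⟩)
      · exact hP' (h₂.left_subset h'.1)
  · intro a ha
    have hS' := hSa a.1
    have d₁ := hdis₁ a.1
    have d₂ := hdis₂ a.1
    constructor
    · by_contra hA
      have hT : a.1 ∈ T₁.1 := not_not.1 fun h' => hA (h.int_mem _ T₁.2 _ h')
      have hP : a ∉ (f T₁).arcs := fun h' => hA ((h.mem_arcs_of_mem hf hT).1 h')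
      have hP' := ((f T₁).rev_mem_arcs a).2 hP
      have k₂ := hY₁ a.rev
      have k₃ := hY₂ a.rev
      rw [rev_fst] at k₂ k₃
      rcases mem_of_arcChain_sub_pos ha with h' | h'
      · exact hP (h₁.right_subset h'.1)
      · have e := (k₃.1 h'.1).2
        exact h'.2 (k₂.2 ⟨hP', not_not.1 fun hn => (hS'.1 ⟨Or.inl hT, hn⟩).2 e⟩)
    · by_contra hA
      have hT : a.1 ∈ T₂.1 := not_not.1 fun h' => hA (h.int_mem _ T₂.2 _ h')
      have hP' : a.rev ∉ (f T₂).arcs :=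
        fun h' => hA ((h.mem_arcs_of_mem (a := a.rev) hf hT).1 h')
      have hP := not_not.1 (fun h' => hP' (((f T₂).rev_mem_arcs a).2 h'))
      have k₁ := hY₁ a
      have k₃ := hY₂ a
      rcases mem_of_arcChain_sub_pos ha with h' | h'
      · have e := (k₁.1 h'.1).2
        exact h'.2 (k₃.2 ⟨hP, not_not.1 fun hn => (hS'.2 ⟨Or.inl hT, hn⟩).2 e⟩)
      · exact hP' (h₂.right_subset h'.1)
  · intro a hT hc hd
    have hS' := hSa a.1
    have d₁ := hdis₁ a.1
    have d₂ := hdis₂ a.1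
    -- An edge of exactly one tree must be used by one of the four sets, for otherwise the subgraphs
    -- would differ on it.
    by_cases e₁ : a.1 ∈ arcEdges X₁ ∨ a.1 ∈ arcEdges X₂
    · exact mem_arcs_iff_of_arcChain_eq h₁.left_subset h₂.left_subset (sub_eq_zero.1 hc) e₁
    · refine mem_arcs_iff_of_arcChain_eq h₁.right_subset h₂.right_subset (sub_eq_zero.1 hd) ?_
      clear d₁ d₂ hSa hdis₁ hdis₂ hX₁ hX₂ hY₁ hY₂ hc hd hS
      tauto

theorem exists_isSubgraphOrientationBijection [Fintype E]
    (hbij : Function.Bijective fun T => Quotient.mk G.cycleCocycleSetoid (f T)) :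
    ∃ φ : EdgeOrientation E → Set E, G.IsSubgraphOrientationBijection f φ := by
  classical
  have ex : ∀ O, ∃ T X Y, G.IsSplitReversal (f T) O X Y := by
    intro O
    obtain ⟨T, hT⟩ := hbij.2 (Quotient.mk _ O)
    exact ⟨T, cycleCocycleSetoid_iff.1 (Quotient.exact hT)⟩
  choose T X Y hs using ex
  have huniq : ∀ {O T' X' Y'}, G.IsSplitReversal (f T') O X' Y' →
      T' = T O ∧ X' = X O ∧ Y' = Y O := by
    intro O T' X' Y' h'
    obtain rfl : T' = T O := hbij.1 (Quotient.sound
      (Setoid.trans' _ h'.cycleCocycleSetoid (Setoid.symm' _ (hs O).cycleCocycleSetoid)))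
    exact ⟨rfl, h'.unique (hs O)⟩
  let φ : EdgeOrientation E → Set E := fun O => ((T O).1 ∪ arcEdges (X O)) \ arcEdges (Y O)
  have hφ : ∀ {O T' X' Y'}, G.IsSplitReversal (f T') O X' Y' →
      φ O = (T'.1 ∪ arcEdges X') \ arcEdges Y' := by
    intro O T' X' Y' h'
    obtain ⟨rfl, rfl, rfl⟩ := huniq h'
    rfl
  have hforest : ∀ O, G.IsForest (φ O) ↔ X O = ∅ := by
    intro O
    constructor
    · intro hF
      obtain ⟨𝒞, 𝒟, hd, hC, -⟩ := (hs O).exists_differBy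
      rw [← hC, Set.sUnion_eq_empty]
      intro C hCm
      refine absurd ?_ (hF C (hd.cycles C hCm))
      intro e he
      have heX : e ∈ arcEdges (X O) :=
        arcEdges_mono (hC ▸ Set.subset_sUnion_of_mem hCm) he
      exact ⟨Or.inr heX, Set.disjoint_left.1 (hs O).disjoint_arcEdges heX⟩
    · intro hX
      refine (T O).2.1.mono ?_
      simp only [φ, hX, arcEdges, Set.image_empty, Set.union_empty]
      exact Set.sdiff_subset
  have hconn : ∀ O, G.IsConnectedSpanning (φ O) ↔ Y O = ∅ := by
    intro O
    constructor
    · intro hF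
      obtain ⟨𝒞, 𝒟, hd, -, hD⟩ := (hs O).exists_differBy
      rw [← hD, Set.sUnion_eq_empty]
      intro D hDm
      exfalso
      have hDY : D ⊆ Y O := hD ▸ Set.subset_sUnion_of_mem hDm
      obtain ⟨⟨a, ha⟩, S, rfl, -⟩ := hd.cocycles D hDm
      obtain ⟨b, hb, hbS⟩ := (hF (G.tail a) (G.head a)).exists_exit ha.1 ha.2
      -- A connected subgraph meets the cut of `D`, but all edges of `Y O` have been removed from `φ
      -- O`.
      exact hb.2 ⟨b, hDY hbS, rfl⟩
    · intro hY
      refine (T O).2.2.mono ?_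
      simp only [φ, hY, arcEdges, Set.image_empty, Set.sdiff_empty]
      exact Set.subset_union_left
  have hinj : Function.Injective φ := by
    intro O₁ O₂ hO
    have hT := h.tree_eq_of_subgraph_eq hf (hs O₁) (hs O₂) hO
    have h₂ := hs O₂
    rw [← hT] at h₂
    exact orientation_eq_of_subgraph_eq (hs O₁) h₂ ((hφ (hs O₁)).symm.trans (hO.trans (hφ h₂)))
  refine ⟨φ, ⟨?_, ?_, ?_, ?_, ?_, ?_⟩⟩
  · intro O
    obtain ⟨𝒞, 𝒟, hd, -, -⟩ := (hs O).exists_differBy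
    exact ⟨T O, 𝒞, 𝒟, hd⟩
  · exact fun O T' 𝒞 𝒟 hd => hφ hd.isSplitReversal
  · intro T'
    have h0 : G.IsSplitReversal (f T') (f T') ∅ ∅ := by
      refine ⟨Set.empty_subset _, Set.empty_subset _, Set.disjoint_empty _, ?_, ?_, ?_⟩
      · rw [show arcChain (∅ : Set (HalfEdge E)) = 0 from funext arcChain_empty]
        exact IsFlow.zero
      · rw [show arcChain (∅ : Set (HalfEdge E)) = 0 from funext arcChain_empty]
        exact IsTension.zero
      · have := isReversalOf_diff (f T') (f T')
        rwa [Set.sdiff_self, ← Set.union_self (∅ : Set (HalfEdge E))] at this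
    rw [hφ h0]
    simp [arcEdges]
  · refine hinj.bijective_of_nat_card_le ?_
    rw [Nat.card_eq_fintype_card, Nat.card_eq_fintype_card]
    simp [EdgeOrientation, Fintype.card_set]
  · constructor
    · rintro ⟨O₁, hO₁⟩ ⟨O₂, hO₂⟩ hO
      rw [hforest] at hO₁ hO₂
      have hflow : G.IsFlow (O₁.diffChain O₂) := cycleSetoid_iff.1 (Quotient.exact hO)
      obtain ⟨X', Y', hs', -, -⟩ := exists_isSplitReversal (c := O₁.diffChain O₂) (d := 0) hflow
        IsTension.zero (add_zero _).symm
      have hT : T O₁ = T O₂ := hbij.1 (Quotient.sound (Setoid.trans' _ (hs O₁).cycleCocycleSetoid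
        (Setoid.trans' _ hs'.cycleCocycleSetoid (Setoid.symm' _ (hs O₂).cycleCocycleSetoid))))
      have h₁ := (hs O₁).diffChain_eq
      have h₂ := (hs O₂).diffChain_eq
      rw [← hT] at h₂
      -- Both orientations come from the same tree by tensions alone, so their difference is a flow
      -- and a tension, hence zero.
      have e : O₁.diffChain O₂ = arcChain (Y O₂) - arcChain (Y O₁) := by
        rw [EdgeOrientation.diffChain_eq_sub (f (T O₁)), h₁, h₂, hO₁, hO₂, add_sub_add_left_eq_sub]
      have := hflow.eq_zero_of_isTension (e ▸ (hs O₂).isTension.sub (hs O₁).isTension)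
      exact Subtype.ext (EdgeOrientation.eq_of_diffChain_eq_zero (congrFun this))
    · intro q
      induction q using Quotient.inductionOn with
      | h O =>
      -- The representative of the cycle reversal class is obtained by reversing only the tension
      -- part.
      obtain ⟨O', hO'⟩ := exists_isReversalOf (hs O).right_subset
      have hs' : G.IsSplitReversal (f (T O)) O' ∅ (Y O) :=
        ⟨Set.empty_subset _, (hs O).right_subset, Set.empty_disjoint _, by
          rw [show arcChain (∅ : Set (HalfEdge E)) = 0 from funext arcChain_empty]
          exact IsFlow.zero, (hs O).isTension, by rwa [Set.empty_union]⟩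
      refine ⟨⟨O', (hforest O').2 (huniq hs').2.1.symm⟩, Quotient.sound (cycleSetoid_iff.2 ?_)⟩
      rw [EdgeOrientation.diffChain_eq_sub (f (T O)), (hs O).diffChain_eq,
        show (f (T O)).diffChain O' = _ from funext hO'.diffChain_eq, add_sub_cancel_right]
      exact (hs O).isFlow
  · constructor
    · rintro ⟨O₁, hO₁⟩ ⟨O₂, hO₂⟩ hO
      rw [hconn] at hO₁ hO₂
      have htens : G.IsTension (O₁.diffChain O₂) := cocycleSetoid_iff.1 (Quotient.exact hO)
      obtain ⟨X', Y', hs', -, -⟩ := exists_isSplitReversal (c := 0) (d := O₁.diffChain O₂)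
        IsFlow.zero htens (zero_add _).symm
      have hT : T O₁ = T O₂ := hbij.1 (Quotient.sound (Setoid.trans' _ (hs O₁).cycleCocycleSetoid
        (Setoid.trans' _ hs'.cycleCocycleSetoid (Setoid.symm' _ (hs O₂).cycleCocycleSetoid))))
      have h₁ := (hs O₁).diffChain_eq
      have h₂ := (hs O₂).diffChain_eq
      rw [← hT] at h₂
      have e : O₁.diffChain O₂ = arcChain (X O₂) - arcChain (X O₁) := by
        rw [EdgeOrientation.diffChain_eq_sub (f (T O₁)), h₁, h₂, hO₁, hO₂, add_sub_add_right_eq_sub]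
      have hflow : G.IsFlow (O₁.diffChain O₂) := e ▸ (hs O₂).isFlow.sub (hs O₁).isFlow
      exact Subtype.ext (EdgeOrientation.eq_of_diffChain_eq_zero
        (congrFun (hflow.eq_zero_of_isTension htens)))
    · intro q
      induction q using Quotient.inductionOn with
      | h O =>
      obtain ⟨O', hO'⟩ := exists_isReversalOf (hs O).left_subset
      have hs' : G.IsSplitReversal (f (T O)) O' (X O) ∅ :=
        ⟨(hs O).left_subset, Set.empty_subset _, Set.disjoint_empty _, (hs O).isFlow, by
          rw [show arcChain (∅ : Set (HalfEdge E)) = 0 from funext arcChain_empty]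
          exact IsTension.zero, by rwa [Set.union_empty]⟩
      refine ⟨⟨O', (hconn O').2 (huniq hs').2.2.symm⟩, Quotient.sound (cocycleSetoid_iff.2 ?_)⟩
      rw [EdgeOrientation.diffChain_eq_sub (f (T O)), (hs O).diffChain_eq,
        show (f (T O)).diffChain O' = _ from funext hO'.diffChain_eq, add_sub_cancel_left]
      exact (hs O).isTension

end IsAtlasPair

end Multigraph

/-! ### Counting classes by the reduced Laplacian. -/

namespace Multigraph

variable {V E : Type*} {G : Multigraph V E}

section Incidence

open Matrix

variable [DecidableEq V]

/-- The incidence matrix without the row of the vertex `q`. -/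
def reducedIncidence (G : Multigraph V E) (q : V) : Matrix {v // v ≠ q} E ℤ :=
  fun v e => (if G.head (e, true) = v then 1 else 0) - (if G.tail (e, true) = v then 1 else 0)

variable {q : V}

theorem sum_mul_head_eq [Fintype E] {c : HalfEdge E → ℤ} (hc : ∀ a, c a.rev = - c a)
    (v : {v // v ≠ q}) :
    ∑ a, c a * (if G.head a = v then 1 else 0) =
      ∑ e, G.reducedIncidence q v e * c (e, true) := by
  rw [Fintype.sum_prod_type]
  refine Finset.sum_congr rfl fun e _ => ?_
  have h1 : c (e, false) = - c (e, true) := hc (e, true)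
  have h2 : G.head (e, false) = G.tail (e, true) := rfl
  rw [Fintype.sum_bool, h1, h2, reducedIncidence]
  ring

section Minors

variable [Fintype V]

/-- Adding up the signed columns along a walk from `q` to `w` gives the unit vector of `w`, which
yields an integral right inverse. -/
theorem isUnit_det_of_isConnectedSpanning {p : {v // v ≠ q} → E}
    (hp : G.IsConnectedSpanning (Set.range p)) :
    IsUnit ((G.reducedIncidence q).submatrix id p).det := by
  set M := (G.reducedIncidence q).submatrix id p
  have key : ∀ w, G.Reach (Set.range p) q w →
      ∃ k : {v // v ≠ q} → ℤ, M *ᵥ k = fun v : {v // v ≠ q} => if w = v then (1 : ℤ) else 0 := by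
    intro w hw
    induction hw with
    | refl =>
      refine ⟨0, ?_⟩
      ext v
      simp [v.2.symm]
    | tail _ hbc ih =>
      obtain ⟨⟨e, s⟩, ⟨i, rfl⟩, rfl, rfl⟩ := hbc
      obtain ⟨k, hk⟩ := ih
      have hcol : ∀ v, (M *ᵥ Pi.single i 1) v =
          (if G.head (p i, true) = v then 1 else 0) - (if G.tail (p i, true) = v then 1 else 0) :=
        fun v => by rw [Matrix.mulVec_single_one]; rfl
      cases s
      · refine ⟨k - Pi.single i 1, ?_⟩
        ext v
        have h1 : G.head (p i, false) = G.tail (p i, true) := rfl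
        have h2 : G.tail (p i, false) = G.head (p i, true) := rfl
        rw [Matrix.mulVec_sub, hk, Pi.sub_apply, hcol, h1, h2]
        ring
      · refine ⟨k + Pi.single i 1, ?_⟩
        ext v
        rw [Matrix.mulVec_add, hk, Pi.add_apply, hcol]
        ring
  choose K hK using fun w : {v // v ≠ q} => key w (hp q w)
  refine Matrix.isUnit_det_of_right_inverse (B := (Matrix.of K)ᵀ) ?_
  ext v w
  have := congrFun (hK w) v
  rw [Matrix.mul_apply]
  simp only [Matrix.mulVec, dotProduct] at this
  simp only [Matrix.transpose_apply, Matrix.of_apply, this, Matrix.one_apply]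
  simp [Subtype.ext_iff, eq_comm]

/-- Conservation at `q` follows from the other vertices, since an antisymmetric chain has total sum
zero. -/
theorem isFlow_of_sum_eq_zero [Fintype E] {c : HalfEdge E → ℤ} (hc : ∀ a, c a.rev = - c a)
    (h : ∀ v : {v // v ≠ q}, ∑ e, G.reducedIncidence q v e * c (e, true) = 0) : G.IsFlow c := by
  refine ⟨hc, fun z => ?_⟩
  have hz : ∀ u, z u = z q + ∑ v : {v // v ≠ q}, (z v - z q) * (if u = v then 1 else 0) := by
    intro u
    by_cases hu : u = q
    · subst hu
      rw [Finset.sum_eq_zero fun v _ => by rw [if_neg v.2.symm, mul_zero], add_zero]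
    · rw [Finset.sum_eq_single (⟨u, hu⟩ : {v // v ≠ q})
        (fun v _ hv => by rw [if_neg fun h' => hv (Subtype.ext h'.symm), mul_zero]) (by simp)]
      simp
  have hsum : ∑ a, c a = 0 := by
    have h1 : ∑ a, c a = ∑ a : HalfEdge E, c a.rev := (Equiv.sum_comp revEquiv c).symm
    simp only [hc, Finset.sum_neg_distrib] at h1
    omega
  calc ∑ a, c a * z (G.head a)
      = ∑ a, (c a * z q + ∑ v : {v // v ≠ q},
          (z v - z q) * (c a * (if G.head a = v then 1 else 0))) := by
        refine Finset.sum_congr rfl fun a _ => ?_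
        rw [hz (G.head a), mul_add, Finset.mul_sum]
        congr 1
        exact Finset.sum_congr rfl fun v _ => by ring
    _ = 0 := by
        rw [Finset.sum_add_distrib, ← Finset.sum_mul, hsum, zero_mul, zero_add, Finset.sum_comm]
        refine Finset.sum_eq_zero fun v _ => ?_
        rw [← Finset.mul_sum, sum_mul_head_eq hc, h, mul_zero]

/-- A cycle among the chosen edges gives a dependence of the columns; the indicator function of the
vertices not joined to `q` gives one of the rows. -/
theorem isSpanningTree_of_det_ne_zero [Fintype E] {p : {v // v ≠ q} → E}
    (hp : ((G.reducedIncidence q).submatrix id p).det ≠ 0) :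
    G.IsSpanningTree (Set.range p) := by
  classical
  have hinj : Function.Injective p := by
    intro i j hij
    by_contra hne
    refine hp (Matrix.det_zero_of_column_eq hne fun v => ?_)
    simp [hij]
  constructor
  · intro C hC hs
    refine hp (Matrix.exists_mulVec_eq_zero_iff.1 ⟨fun i => arcChain C (p i, true), ?_, ?_⟩)
    · intro h0
      have hrev : ∀ a ∈ C, a.rev ∉ C := by
        obtain ⟨n, c, -, -, hedge, rfl⟩ := hC
        rintro _ ⟨i, rfl⟩ ⟨j, hj⟩
        obtain rfl : j = i := hedge (congrArg Prod.fst hj : (c j).1 = (c i).rev.1)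
        exact rev_ne _ hj.symm
      obtain ⟨n, c, -, -, -, rfl⟩ := hC
      have hmem : (c 0).1 ∈ arcEdges (Set.range c) := ⟨c 0, ⟨0, rfl⟩, rfl⟩
      obtain ⟨i, hi⟩ := hs hmem
      refine (arcChain_eq_zero hrev).1 (congrFun h0 i) ?_
      rwa [← hi] at hmem
    · ext v
      have hf := hC.isFlow.2 fun u => if u = v then 1 else 0
      rw [sum_mul_head_eq (arcChain_rev C)] at hf
      refine Eq.trans ?_ hf
      refine Fintype.sum_of_injective p hinj _ _ (fun e he => ?_) fun i => rfl
      have h1 : ((e, true) : HalfEdge E) ∉ C := fun h' => he (hs ⟨_, h', rfl⟩)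
      have h2 : HalfEdge.rev (e, true) ∉ C := fun h' => he (hs ⟨_, h', rfl⟩)
      rw [arcChain, arcInd_of_not_mem h1, arcInd_of_not_mem h2, sub_self, mul_zero]
  · have hq : ∀ w, G.Reach (Set.range p) q w := by
      intro w
      by_contra hw
      refine hp (Matrix.exists_vecMul_eq_zero_iff.1
        ⟨fun v => if G.Reach (Set.range p) q v then 0 else 1, ?_, ?_⟩)
      · intro h0
        have hwq : w ≠ q := by
          rintro rfl
          exact hw Relation.ReflTransGen.refl
        have := congrFun h0 ⟨w, hwq⟩
        simp [hw] at this
      · ext i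
        have hsum : ∀ u : V, ∑ v : {v // v ≠ q}, (if G.Reach (Set.range p) q v then 0 else 1) *
            (if u = v then (1 : ℤ) else 0) = if G.Reach (Set.range p) q u then 0 else 1 := by
          intro u
          by_cases hu : u = q
          · subst hu
            rw [Finset.sum_eq_zero fun v _ => by rw [if_neg v.2.symm, mul_zero],
              if_pos (show G.Reach (Set.range p) u u from Relation.ReflTransGen.refl)]
          · rw [Finset.sum_eq_single (⟨u, hu⟩ : {v // v ≠ q})
              (fun v _ hv => by
                rw [if_neg fun h' : u = v => hv (Subtype.ext h'.symm), mul_zero]) (by simp)]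
            simp
        have hiff : G.Reach (Set.range p) q (G.head (p i, true)) ↔
            G.Reach (Set.range p) q (G.tail (p i, true)) := by
          constructor
          · intro h'
            have := Reach.tail_step (a := (p i, false)) (T := Set.range p) (u := q) (G := G) h'
              ⟨i, rfl⟩
            exact this
          · exact fun h' => h'.tail_step ⟨i, rfl⟩
        simp only [Matrix.vecMul, dotProduct, Matrix.submatrix_apply, id_eq, reducedIncidence,
          mul_sub, Finset.sum_sub_distrib, hsum, hiff, sub_self, Pi.zero_apply]
    exact fun u v => (hq u).symm.trans (hq v)

/-- Each row of the product is a combination of the rows of `Nᵀ`; the determinant is expanded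
multilinearly. This is Cauchy–Binet before grouping. -/
theorem det_mul_transpose_eq_sum {n m : Type*} [Fintype n] [DecidableEq n] [Fintype m]
    (N : Matrix n m ℤ) :
    (N * Nᵀ).det = ∑ p : n → m, (∏ i, N i (p i)) * (N.submatrix id p).det := by
  classical
  have h : N * Nᵀ = fun i => ∑ e, N i e • Nᵀ e := by
    ext i j
    simp [Matrix.mul_apply, Finset.sum_apply]
  rw [h]
  change Matrix.detRowAlternating _ = _
  rw [← AlternatingMap.coe_multilinearMap, MultilinearMap.map_sum]
  refine Finset.sum_congr rfl fun p _ => ?_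
  rw [MultilinearMap.map_smul_univ, smul_eq_mul, ← Matrix.det_transpose (N.submatrix id p)]
  rfl

/-- The maps with the same range are the rearrangements of `p₀`, and their terms add up to the
square of the minor. -/
theorem sum_fiber_eq_one {n m : Type*} [Fintype n] [DecidableEq n] [Fintype m] [DecidableEq m]
    (N : Matrix n m ℤ) {p₀ : n → m} (hp₀ : Function.Injective p₀)
    (hu : IsUnit (N.submatrix id p₀).det) :
    ∑ p : n → m with Set.range p = Set.range p₀,
      (∏ i, N i (p i)) * (N.submatrix id p).det = 1 := by
  classical
  have himage : (Finset.univ.filter fun p : n → m => Set.range p = Set.range p₀) =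
      Finset.univ.image fun σ : Equiv.Perm n => p₀ ∘ σ := by
    ext p
    simp only [Finset.mem_filter, Finset.mem_univ, true_and, Finset.mem_image]
    constructor
    · intro hp
      choose s hs using fun i => hp ▸ Set.mem_range_self (f := p) i
      have hsurj : Function.Surjective s := by
        intro j
        obtain ⟨i, hi⟩ : p₀ j ∈ Set.range p := hp ▸ Set.mem_range_self j
        exact ⟨i, hp₀ ((hs i).trans hi)⟩
      exact ⟨Equiv.ofBijective s (Finite.surjective_iff_bijective.1 hsurj), funext hs⟩
    · rintro ⟨σ, rfl⟩
      exact σ.surjective.range_comp p₀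
  rw [himage, Finset.sum_image (g := fun σ : Equiv.Perm n => p₀ ∘ σ)
    fun σ _ τ _ h => Equiv.ext fun i => hp₀ (congrFun h i)]
  have hterm : ∀ σ : Equiv.Perm n, (∏ i, N i ((p₀ ∘ σ) i)) * (N.submatrix id (p₀ ∘ σ)).det =
      ((Equiv.Perm.sign σ : ℤ) * ∏ i, (N.submatrix id p₀)ᵀ (σ i) i) *
        (N.submatrix id p₀).det := by
    intro σ
    have h1 : N.submatrix id (p₀ ∘ σ) = (N.submatrix id p₀).submatrix id σ := rfl
    rw [h1, Matrix.det_permute']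
    simp only [Matrix.transpose_apply, Matrix.submatrix_apply, id_eq, Function.comp_apply,
      Int.cast_id]
    ring
  rw [Finset.sum_congr rfl fun σ _ => hterm σ, ← Finset.sum_mul]
  have hdet := Matrix.det_apply' (N.submatrix id p₀)ᵀ
  simp only [Int.cast_id] at hdet
  rw [← hdet, Matrix.det_transpose]
  rcases Int.isUnit_iff.1 hu with h | h <;> rw [h] <;> rfl

theorem abs_det_reducedLaplacian_le [Fintype E] :
    |((G.reducedIncidence q) * (G.reducedIncidence q)ᵀ).det| ≤ Nat.card G.SpanningTree := by
  classical
  rw [det_mul_transpose_eq_sum, ← Finset.sum_fiberwise Finset.univ fun p => Set.range p]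
  have hle : ∀ S : Set E, |∑ p : {v // v ≠ q} → E with Set.range p = S,
      (∏ i, G.reducedIncidence q i (p i)) * ((G.reducedIncidence q).submatrix id p).det| ≤
        if G.IsSpanningTree S then 1 else 0 := by
    intro S
    by_cases hex : ∃ p₀ : {v // v ≠ q} → E, Set.range p₀ = S ∧
        ((G.reducedIncidence q).submatrix id p₀).det ≠ 0
    · obtain ⟨p₀, rfl, hdet⟩ := hex
      have hT := isSpanningTree_of_det_ne_zero hdet
      rw [if_pos hT, sum_fiber_eq_one _ _ (isUnit_det_of_isConnectedSpanning hT.2), abs_one]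
      intro i j hij
      by_contra hne
      refine hdet (Matrix.det_zero_of_column_eq hne fun v => ?_)
      simp [hij]
    · push Not at hex
      rw [Finset.sum_eq_zero]
      · split_ifs <;> simp
      · intro p hp
        rw [hex p (Finset.mem_filter.1 hp).2, mul_zero]
  refine (Finset.abs_sum_le_sum_abs _ _).trans ((Finset.sum_le_sum fun S _ => hle S).trans ?_)
  rw [Finset.sum_boole, Nat.card_eq_fintype_card, Fintype.card_subtype]

theorem mulVec_laplacian_apply [Fintype E] (y : {v // v ≠ q} → ℤ) (v : {v // v ≠ q}) :
    ((G.reducedIncidence q * (G.reducedIncidence q)ᵀ) *ᵥ y) v =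
      ∑ e, G.reducedIncidence q v e *
        G.coboundary (fun u => if h : u = q then 0 else y ⟨u, h⟩) (e, true) := by
  rw [← Matrix.mulVec_mulVec]
  simp only [Matrix.mulVec, dotProduct]
  refine Finset.sum_congr rfl fun e _ => ?_
  congr 1
  have hsum : ∀ u : V, ∑ w : {v // v ≠ q}, (if u = w then (1 : ℤ) else 0) * y w =
      if h : u = q then 0 else y ⟨u, h⟩ := by
    intro u
    by_cases hu : u = q
    · subst hu
      rw [Finset.sum_eq_zero fun v _ => by rw [if_neg v.2.symm, zero_mul], dif_pos rfl]
    · rw [Finset.sum_eq_single (⟨u, hu⟩ : {v // v ≠ q})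
        (fun v _ hv => by
          rw [if_neg fun h' : u = v => hv (Subtype.ext h'.symm), zero_mul]) (by simp)]
      simp [hu]
  simp only [Matrix.transpose_apply, reducedIncidence, sub_mul, Finset.sum_sub_distrib, hsum,
    coboundary]

/-- A kernel vector, extended by `0` at `q`, has a coboundary that is also a flow, hence zero; the
potential is then constant. -/
theorem det_reducedLaplacian_ne_zero [Fintype E] (hG : G.Connected) :
    ((G.reducedIncidence q) * (G.reducedIncidence q)ᵀ).det ≠ 0 := by
  intro h0
  obtain ⟨y, hy, hLy⟩ := Matrix.exists_mulVec_eq_zero_iff.2 h0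
  refine hy (funext fun v => ?_)
  set z : V → ℤ := fun u => if h : u = q then 0 else y ⟨u, h⟩ with hz
  have hflow : G.IsFlow (G.coboundary z) := isFlow_of_sum_eq_zero (q := q) (coboundary_rev z)
    fun v => by rw [← mulVec_laplacian_apply, hLy]; rfl
  have hzero := hflow.eq_zero_of_isTension ⟨z, rfl⟩
  have := reach_iff_of_crossing (G := G) (S := {w | z w = 0}) (T := Set.univ) (fun b _ => by
    have := congrFun hzero b
    rw [coboundary, Pi.zero_apply, sub_eq_zero] at this
    simp only [Set.mem_ofPred_eq, this]) (hG.2 q v)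
  have hv := this.1 (by simp [hz])
  simpa [hz, v.2] using hv

/-- If the indegrees of two orientations differ by an element of the Laplacian lattice, subtracting
the coboundary of that potential from their difference leaves a flow, so they are equivalent. The
index of the lattice is the absolute value of the determinant. -/
theorem card_classes_le [Fintype E] (hG : G.Connected) :
    Nat.card (Quotient G.cycleCocycleSetoid) ≤ Nat.card G.SpanningTree := by
  classical
  obtain ⟨q⟩ := hG.1
  set L := (G.reducedIncidence q) * (G.reducedIncidence q)ᵀ with hL
  have hdet : L.det ≠ 0 := det_reducedLaplacian_ne_zero hG
  have hinj : Function.Injective L.toLin' := by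
    rw [← LinearMap.ker_eq_bot, LinearMap.ker_eq_bot']
    intro y hy
    by_contra hne
    exact hdet (Matrix.exists_mulVec_eq_zero_iff.1 ⟨y, hne, hy⟩)
  have hcard : L.det.natAbs = Nat.card (({v // v ≠ q} → ℤ) ⧸ LinearMap.range L.toLin') := by
    rw [← Submodule.natAbs_det_equiv _ (LinearEquiv.ofInjective L.toLin' hinj),
      ← LinearMap.det_toLin' L]
    rfl
  have : Finite (({v // v ≠ q} → ℤ) ⧸ LinearMap.range L.toLin') :=
    Nat.finite_of_card_ne_zero (hcard ▸ Int.natAbs_ne_zero.2 hdet)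
  let indeg : EdgeOrientation E → {v // v ≠ q} → ℤ := fun O v =>
    ∑ a, arcInd O.arcs a * (if G.head a = v then 1 else 0)
  have hindeg : ∀ O O' : EdgeOrientation E,
      indeg O - indeg O' ∈ LinearMap.range L.toLin' → G.cycleCocycleSetoid O O' := by
    rintro O O' ⟨y, hy⟩
    set z : V → ℤ := fun u => if h : u = q then 0 else y ⟨u, h⟩
    have hflow : G.IsFlow (O.diffChain O' - G.coboundary z) := by
      refine isFlow_of_sum_eq_zero (q := q) (fun a => ?_) fun v => ?_
      · simp only [Pi.sub_apply, O.diffChain_rev, coboundary_rev]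
        ring
      · have h1 := congrFun hy v
        rw [Matrix.toLin'_apply, mulVec_laplacian_apply] at h1
        have h2 : (indeg O - indeg O') v =
            ∑ e, G.reducedIncidence q v e * O.diffChain O' (e, true) := by
          rw [← sum_mul_head_eq (O.diffChain_rev O')]
          simp only [indeg, Pi.sub_apply, EdgeOrientation.diffChain, sub_mul,
            Finset.sum_sub_distrib]
        simp only [Pi.sub_apply, mul_sub, Finset.sum_sub_distrib]
        rw [sub_eq_zero, ← h2, ← h1]
    obtain ⟨X, Y, hs, -, -⟩ := exists_isSplitReversal hflow ⟨z, rfl⟩ (sub_add_cancel _ _).symm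
    exact hs.cycleCocycleSetoid
  have hle : Nat.card (Quotient G.cycleCocycleSetoid) ≤
      Nat.card (({v // v ≠ q} → ℤ) ⧸ LinearMap.range L.toLin') := by
    refine Nat.card_le_card_of_injective
      (fun x => Submodule.Quotient.mk (indeg (Quotient.out x))) fun x x' hx => ?_
    have := hindeg _ _ ((Submodule.Quotient.eq _).1 hx)
    rw [← Quotient.out_eq x, ← Quotient.out_eq x']
    exact Quotient.sound this
  rw [← hcard] at hle
  have hdle : |L.det| ≤ Nat.card G.SpanningTree := abs_det_reducedLaplacian_le
  rw [Int.abs_eq_natAbs] at hdle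
  omega

end Minors

end Incidence

end Multigraph

/-! ### Conclusion. -/

namespace Multigraph

variable {V E : Type*} {G : Multigraph V E}

theorem IsAtlasPair.exists_bijections [Finite V] [Finite E] (hG : G.Connected)
    {A A' : Set E → Set (HalfEdge E)} (h : G.IsAtlasPair A A') :
    ∃ f : G.SpanningTree → EdgeOrientation E, G.IsInducedMap A A' f ∧
      Function.Bijective (fun T => Quotient.mk G.cycleCocycleSetoid (f T)) ∧
      ∃ φ : EdgeOrientation E → Set E, G.IsSubgraphOrientationBijection f φ := by
  classical
  have := Fintype.ofFinite V
  have := Fintype.ofFinite E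
  obtain ⟨f, hf⟩ := h.exists_isInducedMap
  have hbij := (h.injective_quotient hf).bijective_of_nat_card_le (card_classes_le hG)
  exact ⟨f, hf, hbij, h.exists_isSubgraphOrientationBijection hf hbij⟩

end Multigraph

/-- Let `G` be a finite connected graph with a ribbon structure `R`, let `h₀` be the half-edge with
which the Bernardi tour starts, and let `q` be its vertex. The first part is about the Bernardi map,
the second part about its modification by a triangulating cocycle signature `σ`. -/
theorem corollary3p14 {V E : Type*} [Finite V] [Finite E] (G : Multigraph V E)
    (hG : G.Connected) (R : G.RibbonStructure) (h₀ : HalfEdge E) :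
    (∃ f : G.SpanningTree → EdgeOrientation E,
      G.IsInducedMap (R.bernardiAtlas h₀) (G.rootAtlas (G.vert h₀)) f ∧
      Function.Bijective (fun T => Quotient.mk G.cycleCocycleSetoid (f T)) ∧
      ∃ φ : EdgeOrientation E → Set E, G.IsSubgraphOrientationBijection f φ) ∧
    ∀ σ : Set (Set (HalfEdge E)), G.IsCocycleSignature σ → G.IsTriangulating σ →
      ∃ f : G.SpanningTree → EdgeOrientation E,
        G.IsInducedMap (R.bernardiAtlas h₀) (Multigraph.signatureAtlas σ) f ∧
        Function.Bijective (fun T => Quotient.mk G.cycleCocycleSetoid (f T)) ∧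
        ∃ φ : EdgeOrientation E → Set E, G.IsSubgraphOrientationBijection f φ := by
  refine ⟨?_, fun σ hσ hσ' =>
    (Multigraph.isAtlasPair_signatureAtlas R h₀ hσ hσ').exists_bijections hG⟩
  obtain ⟨f, hf, h⟩ := (Multigraph.isAtlasPair_signatureAtlas R h₀
    (Multigraph.isCocycleSignature_rootSignature hG (G.vert h₀))
    (Multigraph.isTriangulating_rootSignature hG (G.vert h₀))).exists_bijections hG
  exact ⟨f, fun T => by rw [Multigraph.rootAtlas_eq_signatureAtlas hG _ T.2]; exact hf T, h⟩
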